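/- Let $R$ be a commutative ring with identity and let $G$ be a finite group whose order is invertible in $R$. Let $B(G)$ be the Burnside ring of $G$ (the Grothendieck ring of finite $G$-sets), and let $B(G,G)$ be the double Burnside ring of $G$: the Grothendieck group of finite $(G,G)$-bisets, with product induced by $(U,V)\mapsto U\times_G V$. Put $RB(G)=R\otimes_{\mathbb Z}B(G)$ and $RB(G,G)=R\otimes_{\mathbb Z}B(G,G)$. Let $\alpha\mapsto\widetilde\alpha$ be the $R$-linear map $RB(G)\to RB(G,G)$ induced by sending a finite $G$-set $X$ to the biset $\widetilde X=G\times X$ with $a\cdot(g,x)\cdot b=(agb,ax)$. Set $$e_G^G=\frac1{|G|}\sum_{K\le G}|K|\,\mu(K,G)\,[G/K]\in RB(G),\qquad \mathcal E(G)=\widetilde{e_G^G}\,RB(G,G)\,\widetilde{e_G^G},$$ where $\mu$ is the M\"obius function of the poset of subgroups of $G$. For a subgroup $L$ of $G\times G$ put $Y_L=\widetilde{e_G^G}\,[(G\times G)/L]\,\widetilde{e_G^G}\in\mathcal E(G)$, where $(G\times G)/L$ is a $(G,G)$-biset by $a\cdot(g,h)L\cdot b=(ag,b^{-1}h)L$.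 For a normal subgroup $M$ of $G$ put $\Delta_M(G)=\{(a,b)\in G\times G\mid ab^{-1}\in M\}$. Let $\Phi(G)$ be the Frattini subgroup of $G$, and set $$\varphi_{\mathbf 1}^G=\sum_{M\trianglelefteq G,\ M\le\Phi(G)}\mu_{\trianglelefteq G}(\mathbf 1,M)\,Y_{\Delta_M(G)}\in\mathcal E(G),$$ where $\mu_{\trianglelefteq G}$ is the M\"obius function of the poset of normal subgroups of $G$. If $G$ is nilpotent, then $\varphi_{\mathbf 1}^G$ is a central idempotent of the algebra $\mathcal E(G)$, that is, $(\varphi_{\mathbf 1}^G)^2=\varphi_{\mathbf 1}^G$ and $\varphi_{\mathbf 1}^G\,x=x\,\varphi_{\mathbf 1}^G$ for all $x\in\mathcal E(G)$. -/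

import Mathlib

open scoped TensorProduct

universe u v

namespace DoubleBurnside

/-! ## The Grothendieck ring of a semiring -/

/-- The Grothendieck ring of a semiring `S`: the group completion of the additive monoid of `S`,
with the unique biadditive multiplication extending the one of `S`. -/
def GrothendieckRing (S : Type u) [Semiring S] : Type u :=
  Algebra.GrothendieckAddGroup S

namespace GrothendieckRing

variable {S : Type u} [Semiring S]

instance : AddCommGroup (GrothendieckRing S) :=
  inferInstanceAs (AddCommGroup (Algebra.GrothendieckAddGroup S))

/-- The canonical additive map from `S` to its Grothendieck ring. -/
def of (S : Type u) [Semiring S] : S →+ GrothendieckRing S :=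
  (Algebra.GrothendieckAddGroup.of : S →+ Algebra.GrothendieckAddGroup S)

/-- The universal property of the group completion. -/
noncomputable def lift {A : Type v} [AddCommGroup A] (f : S →+ A) : GrothendieckRing S →+ A :=
  (Algebra.GrothendieckAddGroup.lift f : Algebra.GrothendieckAddGroup S →+ A)

theorem lift_of {A : Type v} [AddCommGroup A] (f : S →+ A) (s : S) : lift f (of S s) = f s :=
  DFunLike.congr_fun (Algebra.GrothendieckAddGroup.lift.symm_apply_apply f) s

theorem hom_ext {A : Type v} [AddCommGroup A] {f g : GrothendieckRing S →+ A}
    (h : ∀ s, f (of S s) = g (of S s)) : f = g :=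
  (Algebra.GrothendieckAddGroup.lift (M := S) (G := A)).symm.injective
    (AddMonoidHom.ext h)

/-- The biadditive extension of the multiplication of `S`. -/
noncomputable def mulHom (S : Type u) [Semiring S] :
    GrothendieckRing S →+ GrothendieckRing S →+ GrothendieckRing S :=
  lift
    { toFun := fun s => lift ((of S).comp (AddMonoidHom.mulLeft s))
      map_zero' := hom_ext fun t => by simp [lift_of]
      map_add' := fun a b => hom_ext fun t => by simp [lift_of, add_mul] }

noncomputable instance : Mul (GrothendieckRing S) := ⟨fun x y => mulHom S x y⟩

instance : One (GrothendieckRing S) := ⟨of S 1⟩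

theorem mul_def (x y : GrothendieckRing S) : x * y = mulHom S x y := rfl

theorem one_def : (1 : GrothendieckRing S) = of S 1 := rfl

theorem of_mul (a b : S) : of S (a * b) = of S a * of S b := by
  simp [mul_def, mulHom, lift_of]

theorem induction {p : GrothendieckRing S → Prop} (x : GrothendieckRing S)
    (h : ∀ a b : S, p (of S a - of S b)) : p x := by
  have key : ∀ y : Algebra.GrothendieckAddGroup S,
      ∃ a b : S, y = Algebra.GrothendieckAddGroup.of a - Algebra.GrothendieckAddGroup.of b := by
    intro y
    obtain ⟨⟨a, b⟩, hab⟩ := (AddLocalization.addMonoidOf (⊤ : AddSubmonoid S)).surj y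
    exact ⟨a, b, eq_sub_of_add_eq hab⟩
  obtain ⟨a, b, hab⟩ := key x
  exact hab ▸ h a b

theorem zero_mul' (x : GrothendieckRing S) : 0 * x = 0 := by simp [mul_def]
theorem mul_zero' (x : GrothendieckRing S) : x * 0 = 0 := by simp [mul_def]
theorem add_mul' (x y z : GrothendieckRing S) : (x + y) * z = x * z + y * z := by simp [mul_def]
theorem mul_add' (x y z : GrothendieckRing S) : x * (y + z) = x * y + x * z := by simp [mul_def]
theorem sub_mul' (x y z : GrothendieckRing S) : (x - y) * z = x * z - y * z := by simp [mul_def]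
theorem mul_sub' (x y z : GrothendieckRing S) : x * (y - z) = x * y - x * z := by simp [mul_def]

noncomputable instance : Ring (GrothendieckRing S) where
  zero_mul := zero_mul'
  mul_zero := mul_zero'
  left_distrib := mul_add'
  right_distrib := add_mul'
  mul_assoc x y z := by
    induction x using induction with | h a b =>
    induction y using induction with | h c d =>
    induction z using induction with | h e f =>
    simp only [sub_mul', mul_sub', ← of_mul, mul_assoc]
  one_mul x := by
    induction x using induction with | h a b =>
    simp only [one_def, mul_sub', ← of_mul, one_mul]
  mul_one x := by
    induction x using induction with | h a b =>
    simp only [one_def, sub_mul', ← of_mul, mul_one]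
  neg_add_cancel := neg_add_cancel
  zsmul := (· • ·)
  zsmul_zero' := SubNegMonoid.zsmul_zero'
  zsmul_succ' := SubNegMonoid.zsmul_succ'
  zsmul_neg' := SubNegMonoid.zsmul_neg'
  sub_eq_add_neg := sub_eq_add_neg

end GrothendieckRing

/-! ## Finite `G`-sets and the Burnside ring -/

/-- A finite (left) `G`-set. -/
structure FinGSet (G : Type u) [Group G] where
  carrier : Type u
  [finite : Finite carrier]
  [action : MulAction G carrier]

attribute [instance] FinGSet.finite FinGSet.action

namespace FinGSet

variable {G : Type u} [Group G]

/-- Isomorphism of `G`-sets. -/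
def Iso (X Y : FinGSet G) : Prop :=
  ∃ e : X.carrier ≃ Y.carrier, ∀ (g : G) (x : X.carrier), e (g • x) = g • e x

theorem iso_equivalence : Equivalence (Iso (G := G)) where
  refl _ := ⟨Equiv.refl _, fun _ _ => rfl⟩
  symm := by
    rintro X Y ⟨e, he⟩
    exact ⟨e.symm, fun g y => by rw [Equiv.symm_apply_eq, he, Equiv.apply_symm_apply]⟩
  trans := by
    rintro X Y Z ⟨e, he⟩ ⟨f, hf⟩
    exact ⟨e.trans f, fun g x => by simp [he, hf]⟩

instance setoid (G : Type u) [Group G] : Setoid (FinGSet G) := ⟨Iso, iso_equivalence⟩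

/-- The empty `G`-set. -/
def empty (G : Type u) [Group G] : FinGSet G where
  carrier := PEmpty
  action := { smul := fun _ x => x, one_smul := fun _ => rfl, mul_smul := fun _ _ _ => rfl }

/-- The one-point `G`-set. -/
def point (G : Type u) [Group G] : FinGSet G where
  carrier := PUnit
  action := { smul := fun _ x => x, one_smul := fun _ => rfl, mul_smul := fun _ _ _ => rfl }

/-- Disjoint union of `G`-sets. -/
def sum (X Y : FinGSet G) : FinGSet G where
  carrier := X.carrier ⊕ Y.carrier
  action :=
    { smul := fun g => Sum.map (g • ·) (g • ·)
      one_smul := by rintro (x | x) <;> exact congrArg _ (one_smul G x)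
      mul_smul := by rintro a b (x | x) <;> exact congrArg _ (mul_smul a b x) }

/-- Product of `G`-sets, with the diagonal action. -/
def prod (X Y : FinGSet G) : FinGSet G where
  carrier := X.carrier × Y.carrier

/-- The transitive `G`-set `G/H`. -/
def coset [Finite G] (H : Subgroup G) : FinGSet G where
  carrier := G ⧸ H

end FinGSet

/-- Isomorphism classes of finite `G`-sets. -/
def GSetClass (G : Type u) [Group G] : Type (u + 1) := Quotient (FinGSet.setoid G)

namespace GSetClass

variable {G : Type u} [Group G]

/-- The isomorphism class of a finite `G`-set. -/
def mk (X : FinGSet G) : GSetClass G := Quotient.mk _ X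

instance : Zero (GSetClass G) := ⟨mk (FinGSet.empty G)⟩

instance : One (GSetClass G) := ⟨mk (FinGSet.point G)⟩

instance : Add (GSetClass G) where
  add := Quotient.map₂ FinGSet.sum (by
    rintro X X' ⟨e, he⟩ Y Y' ⟨f, hf⟩
    refine ⟨Equiv.sumCongr e f, ?_⟩
    rintro g (x | y)
    · exact congrArg Sum.inl (he g x)
    · exact congrArg Sum.inr (hf g y))

instance : Mul (GSetClass G) where
  mul := Quotient.map₂ FinGSet.prod (by
    rintro X X' ⟨e, he⟩ Y Y' ⟨f, hf⟩
    exact ⟨Equiv.prodCongr e f, fun g p => Prod.ext (he g p.1) (hf g p.2)⟩)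

/-- Isomorphism classes of finite `G`-sets form a commutative semiring for disjoint union
and product. -/
instance : CommSemiring (GSetClass G) where
  nsmul := nsmulRec
  add_assoc := by
    rintro ⟨X⟩ ⟨Y⟩ ⟨Z⟩
    refine Quotient.sound ⟨Equiv.sumAssoc _ _ _, ?_⟩
    rintro g ((x | y) | z) <;> rfl
  add_comm := by
    rintro ⟨X⟩ ⟨Y⟩
    refine Quotient.sound ⟨Equiv.sumComm _ _, ?_⟩
    rintro g (x | y) <;> rfl
  zero_add := by
    rintro ⟨X⟩
    refine Quotient.sound ⟨Equiv.emptySum PEmpty _, ?_⟩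
    rintro g (x | x)
    · exact x.elim
    · rfl
  add_zero := by
    rintro ⟨X⟩
    refine Quotient.sound ⟨Equiv.sumEmpty _ PEmpty, ?_⟩
    rintro g (x | x)
    · rfl
    · exact x.elim
  mul_assoc := by
    rintro ⟨X⟩ ⟨Y⟩ ⟨Z⟩
    exact Quotient.sound ⟨Equiv.prodAssoc _ _ _, fun _ _ => rfl⟩
  mul_comm := by
    rintro ⟨X⟩ ⟨Y⟩
    exact Quotient.sound ⟨Equiv.prodComm _ _, fun _ _ => rfl⟩
  one_mul := by
    rintro ⟨X⟩
    exact Quotient.sound ⟨Equiv.punitProd _, fun _ _ => rfl⟩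
  mul_one := by
    rintro ⟨X⟩
    exact Quotient.sound ⟨Equiv.prodPUnit _, fun _ _ => rfl⟩
  zero_mul := by
    rintro ⟨X⟩
    exact Quotient.sound ⟨Equiv.pemptyProd _, fun _ p => p.1.elim⟩
  mul_zero := by
    rintro ⟨X⟩
    exact Quotient.sound ⟨Equiv.prodPEmpty _, fun _ p => p.2.elim⟩
  left_distrib := by
    rintro ⟨X⟩ ⟨Y⟩ ⟨Z⟩
    refine Quotient.sound ⟨Equiv.prodSumDistrib _ _ _, ?_⟩
    rintro g ⟨x, y | z⟩ <;> rfl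
  right_distrib := by
    rintro ⟨X⟩ ⟨Y⟩ ⟨Z⟩
    refine Quotient.sound ⟨Equiv.sumProdDistrib _ _ _, ?_⟩
    rintro g ⟨x | y, z⟩ <;> rfl

end GSetClass

/-- The Burnside ring `B(G)`. -/
abbrev BurnsideRing (G : Type u) [Group G] : Type (u + 1) := GrothendieckRing (GSetClass G)

/-- The Burnside algebra `R B(G) = R ⊗ B(G)`. -/
abbrev BurnsideAlgebra (R : Type v) [CommRing R] (G : Type u) [Group G] : Type (max v (u + 1)) :=
  R ⊗[ℤ] BurnsideRing G

/-! ## Finite bisets -/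

/-- A finite `(G, H)`-biset: a finite set with a left action of `G` and a right action of `H`
(that is, a left action of `Hᵐᵒᵖ`) which commute. -/
structure FinBiset (G H : Type u) [Group G] [Group H] where
  carrier : Type u
  [finite : Finite carrier]
  [left : MulAction G carrier]
  [right : MulAction Hᵐᵒᵖ carrier]
  [comm : SMulCommClass G Hᵐᵒᵖ carrier]

attribute [instance] FinBiset.finite FinBiset.left FinBiset.right FinBiset.comm

namespace FinBiset

open MulOpposite

variable {G H K L : Type u} [Group G] [Group H] [Group K] [Group L]

/-- Isomorphism of `(G, H)`-bisets. -/
def Iso (U V : FinBiset G H) : Prop :=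
  ∃ e : U.carrier ≃ V.carrier,
    (∀ (g : G) (u : U.carrier), e (g • u) = g • e u) ∧
      ∀ (h : H) (u : U.carrier), e (op h • u) = op h • e u

theorem iso_equivalence : Equivalence (Iso (G := G) (H := H)) where
  refl _ := ⟨Equiv.refl _, fun _ _ => rfl, fun _ _ => rfl⟩
  symm := by
    rintro X Y ⟨e, he, he'⟩
    exact ⟨e.symm, fun g y => by rw [Equiv.symm_apply_eq, he, Equiv.apply_symm_apply],
      fun g y => by rw [Equiv.symm_apply_eq, he', Equiv.apply_symm_apply]⟩
  trans := by
    rintro X Y Z ⟨e, he, he'⟩ ⟨f, hf, hf'⟩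
    exact ⟨e.trans f, fun g x => by simp [he, hf], fun g x => by simp [he', hf']⟩

instance setoid (G H : Type u) [Group G] [Group H] : Setoid (FinBiset G H) :=
  ⟨Iso, iso_equivalence⟩

/-- A biset given by its two commuting actions, written as functions. -/
def ofMaps (X : Type u) [Finite X] (l : G → X → X) (r : X → H → X)
    (l_one : ∀ x, l 1 x = x) (l_mul : ∀ a b x, l (a * b) x = l a (l b x))
    (r_one : ∀ x, r x 1 = x) (r_mul : ∀ x a b, r x (a * b) = r (r x a) b)
    (comm : ∀ a x b, l a (r x b) = r (l a x) b) : FinBiset G H :=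
  letI left : MulAction G X := { smul := l, one_smul := l_one, mul_smul := l_mul }
  letI right : MulAction Hᵐᵒᵖ X :=
    { smul := fun b x => r x (unop b)
      one_smul := r_one
      mul_smul := fun a b x => r_mul x (unop b) (unop a) }
  { carrier := X, left := left, right := right, comm := ⟨fun a b x => comm a x (unop b)⟩ }

/-- The empty biset. -/
def empty (G H : Type u) [Group G] [Group H] : FinBiset G H :=
  ofMaps PEmpty (fun _ x => x) (fun x _ => x) (fun _ => rfl) (fun _ _ _ => rfl) (fun _ => rfl)
    (fun _ _ _ => rfl) (fun _ _ _ => rfl)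

/-- The disjoint union of two bisets. -/
def sum (U V : FinBiset G H) : FinBiset G H :=
  ofMaps (U.carrier ⊕ V.carrier) (fun g => Sum.map (g • ·) (g • ·))
    (fun x h => Sum.map (op h • ·) (op h • ·) x)
    (by rintro (x | x) <;> exact congrArg _ (one_smul G x))
    (by rintro a b (x | x) <;> exact congrArg _ (mul_smul a b x))
    (by rintro (x | x) <;> exact congrArg _ (one_smul Hᵐᵒᵖ x))
    (by rintro (x | x) a b <;> exact congrArg _ (mul_smul (op b) (op a) x))
    (by rintro a (x | x) b <;> exact congrArg _ (smul_comm a (op b) x))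

/-- The identity biset: the set `G`, with left and right multiplication. -/
def one (G : Type u) [Group G] [Finite G] : FinBiset G G where
  carrier := G

/-- The equivalence relation on `U × V` whose classes are the orbits of `H` acting on the right by
`(u, v) · h = (u h, h⁻¹ v)`. -/
def compSetoid (U : FinBiset G H) (V : FinBiset H K) : Setoid (U.carrier × V.carrier) where
  r p q := ∃ h : H, q = (op h • p.1, h⁻¹ • p.2)
  iseqv :=
    { refl := fun p => ⟨1, by simp⟩
      symm := by
        rintro p q ⟨h, rfl⟩
        exact ⟨h⁻¹, by simp [smul_smul]⟩
      trans := by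
        rintro p q r ⟨h, rfl⟩ ⟨k, rfl⟩
        exact ⟨h * k, by simp [smul_smul]⟩ }

/-- The underlying set of `U ×_H V`. -/
def CompCarrier (U : FinBiset G H) (V : FinBiset H K) : Type u := Quotient (compSetoid U V)

section CompCarrier

variable {U : FinBiset G H} {V : FinBiset H K}

/-- The class of `(u, v)` in `U ×_H V`. -/
def pair (u : U.carrier) (v : V.carrier) : CompCarrier U V := Quotient.mk (compSetoid U V) (u, v)

theorem pair_op_smul (h : H) (u : U.carrier) (v : V.carrier) :
    (pair (op h • u) v : CompCarrier U V) = pair u (h • v) :=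
  (Quotient.sound (s := compSetoid U V) ⟨h, by simp⟩ :
    pair u (h • v) = pair (op h • u) v).symm

/-- Functions on `U ×_H V` from balanced functions on `U × V`. -/
def compLift {T : Type u} (f : U.carrier → V.carrier → T)
    (hf : ∀ (h : H) u v, f (op h • u) v = f u (h • v)) : CompCarrier U V → T :=
  Quotient.lift (fun p => f p.1 p.2) (by
    rintro ⟨u, v⟩ _ ⟨h, rfl⟩
    simp [hf])

@[elab_as_elim]
theorem pair_induction {p : CompCarrier U V → Prop} (x : CompCarrier U V)
    (h : ∀ u v, p (pair u v)) : p x :=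
  Quotient.inductionOn x fun q => h q.1 q.2

end CompCarrier

/-- The product `U ×_H V` of bisets, with `g · (u, v) · k = (g u, v k)`. -/
def comp (U : FinBiset G H) (V : FinBiset H K) : FinBiset G K :=
  haveI : Finite (CompCarrier U V) := inferInstanceAs (Finite (Quotient (compSetoid U V)))
  ofMaps (CompCarrier U V)
    (fun g => compLift (fun u v => pair (g • u) v) (fun h u v => by rw [smul_comm, pair_op_smul]))
    (fun x k => compLift (fun u v => pair u (op k • v))
      (fun h u v => by rw [pair_op_smul, smul_comm]) x)
    (fun x => pair_induction x fun u v => congrArg (pair · v) (one_smul G u))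
    (fun a b x => pair_induction x fun u v => congrArg (pair · v) (mul_smul a b u))
    (fun x => pair_induction x fun u v => congrArg (pair u ·) (one_smul Kᵐᵒᵖ v))
    (fun x a b => pair_induction x fun u v => congrArg (pair u ·) (mul_smul (op b) (op a) v))
    (fun a x b => pair_induction x fun _ _ => rfl)

theorem comp_congr {U U' : FinBiset G H} {V V' : FinBiset H K} (hU : Iso U U') (hV : Iso V V') :
    Iso (comp U V) (comp U' V') := by
  obtain ⟨e, he, he'⟩ := hU
  obtain ⟨f, hf, hf'⟩ := hV
  have es : ∀ (h : H) u, e.symm (op h • u) = op h • e.symm u := fun h u => by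
    rw [Equiv.symm_apply_eq, he', Equiv.apply_symm_apply]
  have fs : ∀ (h : H) u, f.symm (h • u) = h • f.symm u := fun h u => by
    rw [Equiv.symm_apply_eq, hf, Equiv.apply_symm_apply]
  refine ⟨⟨compLift (fun u v => pair (e u) (f v)) ?_,
    compLift (fun u v => pair (e.symm u) (f.symm v)) ?_, ?_, ?_⟩, ?_, ?_⟩
  · intro h u v
    rw [he', hf, pair_op_smul]
  · intro h u v
    rw [es, fs, pair_op_smul]
  · intro x
    refine pair_induction x fun u v => ?_
    change pair (e.symm (e u)) (f.symm (f v)) = pair u v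
    simp
  · intro x
    refine pair_induction x fun u v => ?_
    change pair (e (e.symm u)) (f (f.symm v)) = pair u v
    simp
  · intro g x
    exact pair_induction x fun u v => congrArg (pair · (f v)) (he g u)
  · intro k x
    exact pair_induction x fun u v => congrArg (pair (e u) ·) (hf' k v)

theorem comp_assoc (U : FinBiset G H) (V : FinBiset H K) (W : FinBiset K L) :
    Iso (comp (comp U V) W) (comp U (comp V W)) := by
  have h1 : ∀ (w : W.carrier) (h : H) (u : U.carrier) (v : V.carrier),
      (pair (op h • u) (pair v w : CompCarrier V W) : CompCarrier U (comp V W)) =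
        pair u (pair (h • v) w : CompCarrier V W) := fun w h u v => pair_op_smul _ _ _
  have h2 : ∀ (u : U.carrier) (k : K) (v : V.carrier) (w : W.carrier),
      (pair (pair u (op k • v) : CompCarrier U V) w : CompCarrier (comp U V) W) =
        pair (pair u v : CompCarrier U V) (k • w) := fun u k v w =>
    pair_op_smul (U := comp U V) k (pair u v : CompCarrier U V) w
  refine ⟨⟨compLift (U := comp U V)
      (fun x w => compLift (fun u v => pair u (pair v w : CompCarrier V W)) (h1 w) x) ?_,
    compLift (V := comp V W)
      (fun u y => compLift (fun v w => pair (pair u v : CompCarrier U V) w) (h2 u) y) ?_,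
    ?_, ?_⟩, ?_, ?_⟩
  · intro k x w
    refine pair_induction x fun u v => ?_
    exact congrArg (fun z => (pair u z : CompCarrier U (comp V W)))
      (pair_op_smul (U := V) (V := W) k v w)
  · intro h u y
    refine pair_induction y fun v w => ?_
    exact congrArg (fun z => (pair z w : CompCarrier (comp U V) W))
      (pair_op_smul (U := U) (V := V) h u v)
  · intro x
    refine pair_induction x fun y w => ?_
    exact pair_induction y fun u v => rfl
  · intro x
    refine pair_induction x fun u y => ?_
    exact pair_induction y fun v w => rfl
  · intro g x
    refine pair_induction x fun y w => ?_
    exact pair_induction y fun u v => rfl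
  · intro g x
    refine pair_induction x fun y w => ?_
    exact pair_induction y fun u v => rfl

theorem one_comp [Finite G] (U : FinBiset G H) : Iso (comp (one G) U) U := by
  refine ⟨⟨compLift (U := one G) (fun g u => (show G from g) • u) ?_,
    fun u => (pair (U := one G) (1 : G) u), ?_, ?_⟩, ?_, ?_⟩
  · intro h g u
    exact mul_smul (show G from g) h u
  · intro x
    refine pair_induction x fun g u => ?_
    exact (pair_op_smul (U := one G) (V := U) g (1 : G) u).symm.trans
      (congrArg (fun z => (pair z u : CompCarrier (one G) U)) (one_mul (show G from g)))
  · intro u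
    exact one_smul G u
  · intro a x
    exact pair_induction x fun g u => mul_smul a (show G from g) u
  · intro h x
    exact pair_induction x fun g u => smul_comm (show G from g) (op h) u

theorem comp_one [Finite H] (U : FinBiset G H) : Iso (comp U (one H)) U := by
  refine ⟨⟨compLift (V := one H) (fun u h => op (show H from h) • u) ?_,
    fun u => (pair (V := one H) u (1 : H)), ?_, ?_⟩, ?_, ?_⟩
  · intro h u k
    exact (mul_smul (op (show H from k)) (op h) u).symm
  · intro x
    refine pair_induction x fun u h => ?_
    exact (pair_op_smul (U := U) (V := one H) h u (1 : H)).trans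
      (congrArg (fun z => (pair u z : CompCarrier U (one H))) (mul_one (show H from h)))
  · intro u
    exact one_smul Hᵐᵒᵖ u
  · intro g x
    exact pair_induction x fun u h => (smul_comm g (op (show H from h)) u).symm
  · intro k x
    exact pair_induction x fun u h => mul_smul (op k) (op (show H from h)) u

theorem sum_comp (U U' : FinBiset G H) (V : FinBiset H K) :
    Iso (comp (sum U U') V) (sum (comp U V) (comp U' V)) := by
  refine ⟨⟨compLift (U := sum U U') (T := CompCarrier U V ⊕ CompCarrier U' V)
      (fun x v => Sum.map (fun u => pair u v) (fun u => pair u v) x) ?_,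
    Sum.elim (compLift (fun u v => pair (U := sum U U') (Sum.inl u) v) ?_)
      (compLift (fun u v => pair (U := sum U U') (Sum.inr u) v) ?_), ?_, ?_⟩, ?_, ?_⟩
  · rintro h (u | u) v
    · exact congrArg Sum.inl (pair_op_smul h u v)
    · exact congrArg Sum.inr (pair_op_smul h u v)
  · intro h u v
    exact pair_op_smul (U := sum U U') h (Sum.inl u) v
  · intro h u v
    exact pair_op_smul (U := sum U U') h (Sum.inr u) v
  · intro x
    refine pair_induction x ?_
    rintro (u | u) v <;> rfl
  · rintro (x | x)
    · exact pair_induction x fun u v => rfl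
    · exact pair_induction x fun u v => rfl
  · intro g x
    refine pair_induction x ?_
    rintro (u | u) v <;> rfl
  · intro g x
    refine pair_induction x ?_
    rintro (u | u) v <;> rfl

theorem comp_sum (U : FinBiset G H) (V V' : FinBiset H K) :
    Iso (comp U (sum V V')) (sum (comp U V) (comp U V')) := by
  refine ⟨⟨compLift (V := sum V V') (T := CompCarrier U V ⊕ CompCarrier U V')
      (fun u x => Sum.map (fun v => pair u v) (fun v => pair u v) x) ?_,
    Sum.elim (compLift (fun u v => pair (V := sum V V') u (Sum.inl v)) ?_)
      (compLift (fun u v => pair (V := sum V V') u (Sum.inr v)) ?_), ?_, ?_⟩, ?_, ?_⟩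
  · rintro h u (v | v)
    · exact congrArg Sum.inl (pair_op_smul h u v)
    · exact congrArg Sum.inr (pair_op_smul h u v)
  · intro h u v
    exact pair_op_smul (V := sum V V') h u (Sum.inl v)
  · intro h u v
    exact pair_op_smul (V := sum V V') h u (Sum.inr v)
  · intro x
    refine pair_induction x ?_
    rintro u (v | v) <;> rfl
  · rintro (x | x)
    · exact pair_induction x fun u v => rfl
    · exact pair_induction x fun u v => rfl
  · intro g x
    refine pair_induction x ?_
    rintro u (v | v) <;> rfl
  · intro g x
    refine pair_induction x ?_
    rintro u (v | v) <;> rfl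

/-- The transitive biset `(G × H) / L`, with `a · (g, h)L · b = (a g, b⁻¹ h)L`. -/
def coset [Finite G] [Finite H] (L : Subgroup (G × H)) : FinBiset G H :=
  ofMaps ((G × H) ⧸ L) (fun a x => ((a, 1) : G × H) • x) (fun x b => ((1, b⁻¹) : G × H) • x)
    (fun x => one_smul (G × H) x)
    (fun a b x => by rw [smul_smul]; simp)
    (fun x => by rw [inv_one]; exact one_smul (G × H) x)
    (fun x a b => by rw [smul_smul]; simp)
    (fun a x b => by rw [smul_smul, smul_smul]; simp)

/-- The biset `G × X` attached to a `G`-set `X`, with `a · (g, x) · b = (a g b, a x)`. -/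
def tilde [Finite G] (X : FinGSet G) : FinBiset G G :=
  ofMaps (G × X.carrier) (fun a p => (a * p.1, a • p.2)) (fun p b => (p.1 * b, p.2))
    (fun p => Prod.ext (one_mul p.1) (one_smul G p.2))
    (fun a b p => Prod.ext (mul_assoc a b p.1) (mul_smul a b p.2))
    (fun p => Prod.ext (mul_one p.1) rfl)
    (fun p a b => Prod.ext (mul_assoc p.1 a b).symm rfl)
    (fun a p b => Prod.ext (mul_assoc a p.1 b).symm rfl)

end FinBiset

/-! ## The double Burnside algebra -/

/-- Isomorphism classes of finite `(G, H)`-bisets. -/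
def BisetClass (G H : Type u) [Group G] [Group H] : Type (u + 1) :=
  Quotient (FinBiset.setoid G H)

namespace BisetClass

variable {G H : Type u} [Group G] [Group H]

/-- The isomorphism class of a finite biset. -/
def mk (U : FinBiset G H) : BisetClass G H := Quotient.mk _ U

instance : Zero (BisetClass G H) := ⟨mk (FinBiset.empty G H)⟩

instance [Finite G] : One (BisetClass G G) := ⟨mk (FinBiset.one G)⟩

instance : Add (BisetClass G H) where
  add := Quotient.map₂ FinBiset.sum (by
    rintro X X' ⟨e, he, he'⟩ Y Y' ⟨f, hf, hf'⟩
    refine ⟨Equiv.sumCongr e f, ?_, ?_⟩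
    · rintro g (x | y)
      · exact congrArg Sum.inl (he g x)
      · exact congrArg Sum.inr (hf g y)
    · rintro g (x | y)
      · exact congrArg Sum.inl (he' g x)
      · exact congrArg Sum.inr (hf' g y))

instance : Mul (BisetClass G G) where
  mul := Quotient.map₂ FinBiset.comp (fun _ _ hU _ _ hV => FinBiset.comp_congr hU hV)

/-- Isomorphism classes of finite `(G, G)`-bisets form a semiring, for disjoint union and for the
product `(U, V) ↦ U ×_G V`. -/
instance [Finite G] : Semiring (BisetClass G G) where
  nsmul := nsmulRec
  add_assoc := by
    rintro ⟨X⟩ ⟨Y⟩ ⟨Z⟩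
    refine Quotient.sound ⟨Equiv.sumAssoc _ _ _, ?_, ?_⟩ <;> rintro g ((x | y) | z) <;> rfl
  add_comm := by
    rintro ⟨X⟩ ⟨Y⟩
    refine Quotient.sound ⟨Equiv.sumComm _ _, ?_, ?_⟩ <;> rintro g (x | y) <;> rfl
  zero_add := by
    rintro ⟨X⟩
    refine Quotient.sound ⟨Equiv.emptySum PEmpty _, ?_, ?_⟩ <;> rintro g (x | x)
    · exact x.elim
    · rfl
    · exact x.elim
    · rfl
  add_zero := by
    rintro ⟨X⟩
    refine Quotient.sound ⟨Equiv.sumEmpty _ PEmpty, ?_, ?_⟩ <;> rintro g (x | x)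
    · rfl
    · exact x.elim
    · rfl
    · exact x.elim
  mul_assoc := by
    rintro ⟨X⟩ ⟨Y⟩ ⟨Z⟩
    exact Quotient.sound (FinBiset.comp_assoc X Y Z)
  one_mul := by
    rintro ⟨X⟩
    exact Quotient.sound (FinBiset.one_comp X)
  mul_one := by
    rintro ⟨X⟩
    exact Quotient.sound (FinBiset.comp_one X)
  zero_mul := by
    rintro ⟨X⟩
    have h : (FinBiset.comp (FinBiset.empty G G) X).carrier → PEmpty.{u + 1} := fun x =>
      FinBiset.pair_induction (p := fun _ => Nonempty PEmpty.{u + 1}) x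
        (fun y _ => PEmpty.elim y) |>.some
    exact Quotient.sound ⟨⟨h, fun y => y.elim, fun x => (h x).elim, fun y => y.elim⟩,
      fun _ x => (h x).elim, fun _ x => (h x).elim⟩
  mul_zero := by
    rintro ⟨X⟩
    have h : (FinBiset.comp X (FinBiset.empty G G)).carrier → PEmpty.{u + 1} := fun x =>
      FinBiset.pair_induction (p := fun _ => Nonempty PEmpty.{u + 1}) x
        (fun _ y => PEmpty.elim y) |>.some
    exact Quotient.sound ⟨⟨h, fun y => y.elim, fun x => (h x).elim, fun y => y.elim⟩,
      fun _ x => (h x).elim, fun _ x => (h x).elim⟩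
  left_distrib := by
    rintro ⟨X⟩ ⟨Y⟩ ⟨Z⟩
    exact Quotient.sound (FinBiset.comp_sum X Y Z)
  right_distrib := by
    rintro ⟨X⟩ ⟨Y⟩ ⟨Z⟩
    exact Quotient.sound (FinBiset.sum_comp X Y Z)

end BisetClass

section DoubleBurnsideAlgebra

variable (R : Type v) [CommRing R] (G : Type u) [Group G] [Finite G]

/-- The double Burnside ring `B(G, G)`. -/
abbrev DoubleBurnsideRing : Type (u + 1) := GrothendieckRing (BisetClass G G)

/-- The double Burnside algebra `R B(G, G) = R ⊗ B(G, G)`. -/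
abbrev DoubleBurnsideAlgebra : Type (max v (u + 1)) := R ⊗[ℤ] DoubleBurnsideRing G

variable {G}

/-- The element `[G/H]` of `R B(G)`. -/
noncomputable def gsetCoset (H : Subgroup G) : BurnsideAlgebra R G :=
  1 ⊗ₜ[ℤ] GrothendieckRing.of (GSetClass G) (GSetClass.mk (FinGSet.coset H))

/-- The element `[(G × G)/L]` of `R B(G, G)`. -/
noncomputable def bisetCoset (L : Subgroup (G × G)) : DoubleBurnsideAlgebra R G :=
  1 ⊗ₜ[ℤ] GrothendieckRing.of (BisetClass G G) (BisetClass.mk (FinBiset.coset L))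

variable (G)

/-- The additive map from isomorphism classes of `G`-sets to isomorphism classes of `(G, G)`-bisets
induced by `X ↦ G × X`. -/
def tildeClass : GSetClass G →+ BisetClass G G where
  toFun := Quotient.map FinBiset.tilde (by
    rintro X Y ⟨e, he⟩
    exact ⟨Equiv.prodCongr (Equiv.refl G) e, fun g p => Prod.ext rfl (he g p.2),
      fun _ _ => rfl⟩)
  map_zero' := Quotient.sound ⟨Equiv.prodPEmpty G, fun _ p => p.2.elim, fun _ p => p.2.elim⟩
  map_add' := by
    rintro ⟨X⟩ ⟨Y⟩
    refine Quotient.sound ⟨Equiv.prodSumDistrib _ _ _, ?_, ?_⟩ <;>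
      rintro g ⟨x, y | z⟩ <;> rfl

/-- The additive map `B(G) → B(G, G)` induced by `X ↦ G × X`. -/
noncomputable def tildeHom : BurnsideRing G →+ DoubleBurnsideRing G :=
  GrothendieckRing.lift ((GrothendieckRing.of (BisetClass G G)).comp (tildeClass G))

/-- The `R`-linear map `R B(G) → R B(G, G)`, written `α ↦ α̃`. -/
noncomputable def tilde : BurnsideAlgebra R G →ₗ[R] DoubleBurnsideAlgebra R G :=
  (tildeHom G).toIntLinearMap.baseChange R

end DoubleBurnsideAlgebra

/-! ## Idempotents -/

open Classical in
/-- The Möbius function of a finite poset. -/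
noncomputable def moebius {P : Type u} [PartialOrder P] [Finite P] (a b : P) : ℤ :=
  letI : Fintype P := Fintype.ofFinite P
  letI : LocallyFiniteOrder P := Fintype.toLocallyFiniteOrder
  IncidenceAlgebra.mu ℤ a b

section Idempotents

variable (R : Type v) [CommRing R] (G : Type u) [Group G] [Finite G]

variable {G} in
/-- The element `e_H^G = |N_G(H)|⁻¹ ∑_{K ≤ H} |K| μ(K, H) [G/K]` of `R B(G)`, where `μ` is the
Möbius function of the poset of subgroups of `G`. It is meant for `|G|` invertible in `R`. -/
noncomputable def burnsideIdempotent (H : Subgroup G) : BurnsideAlgebra R G :=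
  Ring.inverse (Nat.card (Subgroup.normalizer (H : Set G)) : R) •
    ∑ K ∈ (Set.toFinite {K : Subgroup G | K ≤ H}).toFinset,
      ((Nat.card K : R) * (moebius K H : R)) • gsetCoset R K

/-- The element `ẽ_G^G` of `R B(G, G)`. -/
noncomputable def topIdempotent : DoubleBurnsideAlgebra R G :=
  tilde R G (burnsideIdempotent R (⊤ : Subgroup G))

/-- The `R`-algebra `𝓔(G) = ẽ_G^G R B(G, G) ẽ_G^G`. It is not a unital subalgebra of `R B(G, G)`:
its identity element is `ẽ_G^G`. -/
noncomputable def essentialAlgebra : NonUnitalSubalgebra R (DoubleBurnsideAlgebra R G) where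
  carrier := {x | ∃ a, x = topIdempotent R G * a * topIdempotent R G}
  zero_mem' := ⟨0, by simp⟩
  add_mem' := by
    rintro _ _ ⟨a, rfl⟩ ⟨b, rfl⟩
    exact ⟨a + b, by rw [mul_add, add_mul]⟩
  mul_mem' := by
    rintro _ _ ⟨a, rfl⟩ ⟨b, rfl⟩
    exact ⟨a * topIdempotent R G * topIdempotent R G * b, by simp only [mul_assoc]⟩
  smul_mem' := by
    rintro r _ ⟨a, rfl⟩
    exact ⟨r • a, by rw [mul_smul_comm, smul_mul_assoc]⟩

variable {G}

/-- The element `Y_L = ẽ_G^G [(G × G)/L] ẽ_G^G` of `𝓔(G)`. -/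
noncomputable def Y (L : Subgroup (G × G)) : essentialAlgebra R G :=
  ⟨topIdempotent R G * bisetCoset R L * topIdempotent R G, bisetCoset R L, rfl⟩

/-- The poset of normal subgroups of `G`. -/
abbrev NormalSubgroup (G : Type u) [Group G] : Type u := {N : Subgroup G // N.Normal}

/-- The subgroup `Δ_N(G) = {(a, b) | a b⁻¹ ∈ N}` of `G × G`, for `N` normal in `G`. -/
def deltaSubgroup {G : Type u} [Group G] (N : NormalSubgroup G) : Subgroup (G × G) where
  carrier := {p | p.1 * p.2⁻¹ ∈ N.1}
  one_mem' := by simp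
  mul_mem' := by
    rintro ⟨a, b⟩ ⟨c, d⟩ h h'
    have h2 : (b * d⁻¹)⁻¹ * (b * d⁻¹) = 1 := inv_mul_cancel _
    have := N.1.mul_mem (N.2.conj_mem _ h' a) h
    have e : a * c * (b * d)⁻¹ = a * (c * d⁻¹) * a⁻¹ * (a * b⁻¹) := by group
    change a * c * (b * d)⁻¹ ∈ N.1
    rw [e]
    exact this
  inv_mem' := by
    rintro ⟨a, b⟩ h
    have := N.2.conj_mem _ (N.1.inv_mem h) a⁻¹
    have e : a⁻¹ * (b⁻¹)⁻¹ = a⁻¹ * (a * b⁻¹)⁻¹ * (a⁻¹)⁻¹ := by group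
    change a⁻¹ * (b⁻¹)⁻¹ ∈ N.1
    rw [e]
    exact this

/-- The element `φ_N^G = ∑ μ(N, M) Y_{Δ_M(G)}` of `𝓔(G)`, where `M` runs through the normal
subgroups of `G` with `N ≤ M ≤ Φ(G)` and `μ` is the Möbius function of the poset of normal
subgroups of `G`. It is meant for `N ≤ Φ(G)` and `|G|` invertible in `R`. -/
noncomputable def phi (N : NormalSubgroup G) : essentialAlgebra R G :=
  ∑ M ∈ (Set.toFinite {M : NormalSubgroup G | N ≤ M ∧ M.1 ≤ frattini G}).toFinset,
    (moebius N M : R) • Y R (deltaSubgroup M)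

variable (G)

/-- The element `φ_1^G` of `𝓔(G)`. -/
noncomputable def phiOne : essentialAlgebra R G :=
  phi R (⟨⊥, inferInstance⟩ : NormalSubgroup G)

end Idempotents

end DoubleBurnside

/-! Write e for `topIdempotent`, Φ for the Frattini subgroup, q_M for the class of G/M
(`quotientClass`), [L] for the class of (G × G)/L and f for `frattiniIdempotent`, the sum of μ(1, M)
q_M over normal M ≤ Φ. Then φ = e f e, and the proof rests on three facts.

The idempotent f: since q_M q_N = q_{MN}, a Weisner-type identity gives f q_N = q_N f = 0 for every
normal N with 1 ≠ N ≤ Φ. As q_1 is the identity, f is 1 plus a combination of such q_N, so f² = f.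

The idempotent e: μ(K, G) vanishes unless Φ ≤ K, hence e commutes with every q_M for M ≤ Φ, and so
with f. Since e² = e, φ = f e is idempotent. Moreover e [L] = 0 if the first projection of L is
proper, and [L] e = 0 if the second is: after expansion into orbits this is Weisner's theorem for
subgroups.

Centrality: it is enough that f commutes with [L] when both projections of L are onto. Let k₁, k₂ be
the Goursat kernels of L. For nilpotent G, Φ(G/N) = ΦN/N, so the isomorphism G/k₁ ≅ G/k₂ shows that
each element of Φ is L-related to an element of Φ. Counting L ∩ (Φ × Φ) along both projections gives
|k₁ ∩ Φ| = |k₂ ∩ Φ|. Now let 1 ≠ M ≤ Φ. The composite L' = L ∘ Δ_M has M in its second kernel, so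
its first kernel meets Φ in some N ≠ 1, and f [L] q_M = f [L'] = f q_N [L'] = 0. Hence f [L] f = f
[L]; the mirror argument gives f [L] f = [L] f. -/

namespace DoubleBurnside

/-! ### Möbius functions of finite posets -/

section Moebius

variable {P : Type u} [PartialOrder P] [Finite P]

/-- The interval is passed as an arbitrary finset with the right members, which hides the instances
chosen inside `moebius`. -/
theorem sum_moebius_right (a b : P) (s : Finset P) (hs : ∀ x, x ∈ s ↔ a ≤ x ∧ x ≤ b)
    (hab : a ≠ b) : ∑ x ∈ s, moebius a x = 0 := by
  classical
  let : Fintype P := Fintype.ofFinite P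
  let : LocallyFiniteOrder P := Fintype.toLocallyFiniteOrder
  have h := IncidenceAlgebra.sum_Icc_mu_right (𝕜 := ℤ) a b
  rw [if_neg hab] at h
  rw [← h]
  refine Finset.sum_congr (Finset.ext fun x => by rw [hs, Finset.mem_Icc]) fun x _ => ?_
  unfold moebius
  congr!

theorem sum_moebius_left (a b : P) (s : Finset P) (hs : ∀ x, x ∈ s ↔ a ≤ x ∧ x ≤ b)
    (hab : a ≠ b) : ∑ x ∈ s, moebius x b = 0 := by
  classical
  let : Fintype P := Fintype.ofFinite P
  let : LocallyFiniteOrder P := Fintype.toLocallyFiniteOrder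
  have h := IncidenceAlgebra.sum_Icc_mu_left (𝕜 := ℤ) a b
  rw [if_neg hab] at h
  rw [← h]
  refine Finset.sum_congr (Finset.ext fun x => by rw [hs, Finset.mem_Icc]) fun x _ => ?_
  unfold moebius
  congr!

theorem moebius_self (a : P) : moebius a a = 1 := by
  unfold moebius
  simp

end Moebius

/-- If the sums of the weights `w` over all the sets `{x | g x ≤ j}` vanish, then so do all the
sums `∑ w x • F (g x)`. -/
theorem sum_smul_comp_eq_zero {ι Q A : Type*} [PartialOrder Q] [Finite Q] [AddCommGroup A]
    (s : Finset ι) (w : ι → ℤ) (g : ι → Q)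
    (h : ∀ (j : Q) (t : Finset ι), (∀ x, x ∈ t ↔ x ∈ s ∧ g x ≤ j) → ∑ x ∈ t, w x = 0)
    (F : Q → A) : ∑ x ∈ s, w x • F (g x) = 0 := by
  classical
  let : Fintype Q := Fintype.ofFinite Q
  -- `F (g x)` is constant on the fibres of `g`, so each fibre only needs total weight zero. Induct
  -- on `j`: the fibres strictly below `j` already contribute nothing to the sum over `g x ≤ j`.
  have key : ∀ j : Q, ∑ x ∈ s with g x = j, w x = 0 := by
    intro j
    induction j using WellFoundedLT.induction with
    | _ j ih =>
      have h1 := h j (s.filter fun x => g x ≤ j) (by simp)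
      have h2 : ∑ x ∈ s with g x < j, w x = 0 := by
        rw [← Finset.sum_fiberwise_of_maps_to (s := s.filter fun x => g x < j)
          (t := Finset.univ.filter (· < j)) (g := g) (by simp)]
        refine Finset.sum_eq_zero fun i hi => ?_
        have hi' : i < j := by simpa using hi
        rw [Finset.filter_filter, ← ih i hi']
        refine Finset.sum_congr (Finset.filter_congr fun x _ => ?_) fun _ _ => rfl
        exact ⟨And.right, fun e => ⟨e ▸ hi', e⟩⟩
      have h3 : (s.filter fun x => g x ≤ j) =
          (s.filter fun x => g x < j) ∪ (s.filter fun x => g x = j) := by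
        rw [← Finset.filter_or]
        exact Finset.filter_congr fun x _ => le_iff_lt_or_eq
      rw [h3, Finset.sum_union, h2, zero_add] at h1
      · exact h1
      · exact Finset.disjoint_filter.2 fun x _ h4 h5 => h4.ne h5
  rw [← Finset.sum_fiberwise (s := s) (g := g)]
  refine Finset.sum_eq_zero fun j _ => ?_
  rw [Finset.sum_congr rfl (g := fun x => w x • F j)
    (fun x hx => by rw [(Finset.mem_filter.1 hx).2]), ← Finset.sum_smul, key j, zero_smul]

/-! ### Weisner-type identities for subgroups and normal subgroups -/

section Subgroups

variable {G : Type u} [Group G] [Finite G]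

/-- Weisner's theorem for the Möbius function of the subgroup lattice. -/
theorem sum_moebius_top_inf {A : Type*} [AddCommGroup A] (s : Finset (Subgroup G))
    (hs : ∀ K, K ∈ s) {H : Subgroup G} (hH : H ≠ ⊤) (F : Subgroup G → A) :
    ∑ K ∈ s, moebius K ⊤ • F (K ⊓ H) = 0 := by
  classical
  -- In the dual order the condition reads `J ≤ K ⊓ H`. If `J ≤ H` it amounts to `J ≤ K`, a full
  -- interval sum that vanishes because `J ≠ ⊤`; otherwise no `K` satisfies it.
  refine sum_smul_comp_eq_zero (Q := (Subgroup G)ᵒᵈ) s (fun K => moebius K ⊤)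
    (fun K => OrderDual.toDual (K ⊓ H)) ?_ (fun J => F (OrderDual.ofDual J))
  intro j t ht
  by_cases hj : OrderDual.ofDual j ≤ H
  · refine sum_moebius_left (OrderDual.ofDual j) ⊤ t (fun K => ?_) ?_
    · rw [ht]
      constructor
      · rintro ⟨-, h⟩
        exact ⟨le_trans (OrderDual.toDual_le.1 h) inf_le_left, le_top⟩
      · rintro ⟨h, -⟩
        exact ⟨hs K, OrderDual.toDual_le.2 (le_inf h hj)⟩
    · intro h
      exact hH (top_le_iff.1 (h ▸ hj))
  · have : t = ∅ := by
      refine Finset.eq_empty_of_forall_notMem fun K hK => hj ?_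
      exact le_trans (OrderDual.toDual_le.1 ((ht K).1 hK).2) inf_le_right
    rw [this, Finset.sum_empty]

/-- Elements of Φ are nongenerators, so K < ⊤ forces KΦ < ⊤. The sums of μ(J, ⊤) over J ≥ K and over
J ≥ KΦ are then both zero; by induction from above, the J > K that do not contain Φ contribute
nothing, and the difference of the two sums is μ(K, ⊤). -/
theorem moebius_top_eq_zero {K : Subgroup G} (hK : ¬ frattini G ≤ K) : moebius K ⊤ = 0 := by
  classical
  let : Fintype (Subgroup G) := Fintype.ofFinite _
  induction K using WellFoundedGT.induction with
  | _ K ih =>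
    have hK' : K ≠ ⊤ := fun h => hK (h ▸ le_top)
    have h1 := sum_moebius_left K ⊤ (Finset.univ.filter (K ≤ ·)) (by simp) hK'
    have h2 := sum_moebius_left (K ⊔ frattini G) ⊤ (Finset.univ.filter (K ⊔ frattini G ≤ ·))
      (by simp) fun h => hK' (frattini_nongenerating h)
    have h3 : ∑ J ∈ Finset.univ.filter (K ≤ ·), moebius J ⊤ =
        moebius K ⊤ + ∑ J ∈ Finset.univ.filter (K < ·), moebius J ⊤ := by
      rw [← Finset.sum_insert (a := K) (f := fun J => moebius J ⊤) (by simp)]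
      refine Finset.sum_congr (Finset.ext fun J => ?_) fun _ _ => rfl
      simp only [Finset.mem_filter, Finset.mem_univ, true_and, Finset.mem_insert]
      rw [le_iff_lt_or_eq, or_comm, eq_comm]
    have h4 : ∑ J ∈ Finset.univ.filter (K < ·), moebius J ⊤ =
        ∑ J ∈ Finset.univ.filter (K ⊔ frattini G ≤ ·), moebius J ⊤ := by
      symm
      refine Finset.sum_subset (fun J hJ => ?_) fun J hJ hJ' => ?_
      · simp only [Finset.mem_filter, Finset.mem_univ, true_and] at hJ ⊢
        refine lt_of_le_of_ne (le_sup_left.trans hJ) fun h => hK ?_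
        exact h ▸ le_sup_right.trans hJ
      · simp only [Finset.mem_filter, Finset.mem_univ, true_and] at hJ hJ'
        exact ih J hJ fun h => hJ' (sup_le hJ.le h)
    rw [h3, h4, h2, add_zero] at h1
    exact h1

/-- The join of two normal subgroups. -/
def NormalSubgroup.join {G : Type u} [Group G] (M N : NormalSubgroup G) : NormalSubgroup G :=
  ⟨M.1 ⊔ N.1, Subgroup.sup_normal _ _ (hH := M.2) (hK := N.2)⟩

/-- For J ≥ N, the M ≤ Φ with MN ≤ J are exactly those in the interval [1, J ∩ Φ], which is
nontrivial because it contains N. -/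
theorem sum_moebius_bot_join {A : Type*} [AddCommGroup A] (s : Finset (NormalSubgroup G))
    (hs : ∀ M, M ∈ s ↔ M.1 ≤ frattini G) {N : NormalSubgroup G} (hN : N.1 ≠ ⊥)
    (hN' : N.1 ≤ frattini G) (F : NormalSubgroup G → A) :
    ∑ M ∈ s, moebius (⟨⊥, inferInstance⟩ : NormalSubgroup G) M • F (M.join N) = 0 := by
  refine sum_smul_comp_eq_zero s _ (fun M => M.join N) (fun J t ht => ?_) F
  by_cases hj : N ≤ J
  · have := J.2
    refine sum_moebius_right _ (⟨J.1 ⊓ frattini G, inferInstance⟩ : NormalSubgroup G) t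
      (fun M => ?_) ?_
    · rw [ht, hs]
      constructor
      · rintro ⟨h1, h2⟩
        exact ⟨(bot_le : (⊥ : Subgroup G) ≤ M.1),
          (le_inf (le_trans le_sup_left h2) h1 : M.1 ≤ J.1 ⊓ frattini G)⟩
      · rintro ⟨-, h⟩
        have h' : M.1 ≤ J.1 ⊓ frattini G := h
        exact ⟨h'.trans inf_le_right, (sup_le (h'.trans inf_le_left) hj : M.1 ⊔ N.1 ≤ J.1)⟩
    · intro h
      have h' : ⊥ = J.1 ⊓ frattini G := congrArg Subtype.val h
      exact hN (le_bot_iff.1 (h' ▸ le_inf hj hN'))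
  · have : t = ∅ := by
      refine Finset.eq_empty_of_forall_notMem fun M hM => hj ?_
      exact (le_sup_right : N.1 ≤ M.1 ⊔ N.1).trans ((ht M).1 hM).2
    rw [this, Finset.sum_empty]

end Subgroups

/-! ### Orbit decompositions of finite group actions -/

namespace FinGSet

variable {Γ : Type u} [Group Γ]

/-- The sub-`Γ`-set of `X` on an invariant subset. -/
def sub (X : FinGSet Γ) (p : X.carrier → Prop) (hp : ∀ (g : Γ) x, p x → p (g • x)) : FinGSet Γ where
  carrier := {x // p x}
  action :=
    { smul := fun g x => ⟨g • x.1, hp g x.1 x.2⟩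
      one_smul := fun x => Subtype.ext (one_smul Γ x.1)
      mul_smul := fun a b x => Subtype.ext (mul_smul a b x.1) }

/-- A `G`-set viewed as a `Γ`-set through a homomorphism `π : Γ →* G`. -/
def res {G : Type u} [Group G] (π : Γ →* G) (X : FinGSet G) : FinGSet Γ where
  carrier := X.carrier
  action := MulAction.compHom X.carrier π

theorem iso_coset_of_transitive [Finite Γ] (X : FinGSet Γ) (x : X.carrier)
    (hx : ∀ y, ∃ g : Γ, g • x = y) : Iso X (coset (MulAction.stabilizer Γ x)) := by
  refine iso_equivalence.symm ⟨Equiv.ofBijective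
    (MulAction.ofQuotientStabilizer Γ x) ⟨MulAction.injective_ofQuotientStabilizer Γ x, ?_⟩, ?_⟩
  · intro y
    obtain ⟨g, rfl⟩ := hx y
    exact ⟨QuotientGroup.mk g, MulAction.ofQuotientStabilizer_mk Γ x g⟩
  · intro g y
    exact MulAction.ofQuotientStabilizer_smul Γ x g y

end FinGSet

namespace GSetClass

variable {Γ : Type u} [Group Γ]

theorem mk_eq {X Y : FinGSet Γ} (h : FinGSet.Iso X Y) : mk X = mk Y := Quotient.sound h

theorem mk_of_isEmpty (X : FinGSet Γ) [IsEmpty X.carrier] : mk X = 0 :=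
  mk_eq ⟨Equiv.equivOfIsEmpty _ PEmpty, fun _ x => isEmptyElim x⟩

theorem mk_sub_add_mk_sub_not (X : FinGSet Γ) (p : X.carrier → Prop)
    (hp : ∀ (g : Γ) x, p x → p (g • x)) (hp' : ∀ (g : Γ) x, ¬ p x → ¬ p (g • x)) :
    mk X = mk (X.sub p hp) + mk (X.sub (fun x => ¬ p x) hp') := by
  classical
  refine (mk_eq ⟨Equiv.sumCompl p, ?_⟩).symm
  rintro g (x | x) <;> rfl

/-- Every finite `Γ`-set is a disjoint union of coset spaces. -/
theorem coset_induction [Finite Γ] {p : GSetClass Γ → Prop} (h0 : p 0)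
    (hadd : ∀ x y, p x → p y → p (x + y)) (hc : ∀ L : Subgroup Γ, p (mk (FinGSet.coset L)))
    (x : GSetClass Γ) : p x := by
  have key : ∀ (n : ℕ) (X : FinGSet Γ), Nat.card X.carrier = n → p (mk X) := by
    intro n
    induction n using Nat.strong_induction_on with
    | _ n ih =>
      intro X hX
      rcases isEmpty_or_nonempty X.carrier with hE | ⟨⟨x⟩⟩
      · rw [mk_of_isEmpty]
        exact h0
      · have hp : ∀ (g : Γ) y, y ∈ MulAction.orbit Γ x → g • y ∈ MulAction.orbit Γ x :=
          fun g y hy => MulAction.mem_orbit_of_mem_orbit g hy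
        have hp' : ∀ (g : Γ) y, y ∉ MulAction.orbit Γ x → g • y ∉ MulAction.orbit Γ x :=
          fun g y hy h => hy (by simpa using MulAction.mem_orbit_of_mem_orbit g⁻¹ h)
        rw [mk_sub_add_mk_sub_not X (· ∈ MulAction.orbit Γ x) hp hp']
        refine hadd _ _ ?_ (ih _ ?_ _ rfl)
        · let O := X.sub (· ∈ MulAction.orbit Γ x) hp
          let x' : O.carrier := ⟨x, MulAction.mem_orbit_self x⟩
          have := FinGSet.iso_coset_of_transitive O x' (by
            rintro ⟨_, g, rfl⟩
            exact ⟨g, rfl⟩)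
          change p (mk O)
          rw [mk_eq this]
          exact hc _
        · rw [← hX]
          exact Finite.card_subtype_lt (p := fun y => y ∉ MulAction.orbit Γ x) (x := x)
            fun h => h (MulAction.mem_orbit_self x)
  exact Quotient.inductionOn x fun X => key _ X rfl

noncomputable instance carrierFintype (X : FinGSet Γ) : Fintype X.carrier :=
  Fintype.ofFinite X.carrier

/-- The sum `∑ |Γ_x| [Γ / Γ_x]` over the points `x` of a finite `Γ`-set. -/
noncomputable def stabilizerSum [Finite Γ] (X : FinGSet Γ) : GSetClass Γ :=
  ∑ x : X.carrier, Nat.card (MulAction.stabilizer Γ x) •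
    mk (FinGSet.coset (MulAction.stabilizer Γ x))

theorem stabilizerSum_congr [Finite Γ] {X Y : FinGSet Γ} (h : FinGSet.Iso X Y) :
    stabilizerSum X = stabilizerSum Y := by
  obtain ⟨e, he⟩ := h
  refine Fintype.sum_equiv e _ _ fun x => ?_
  have : MulAction.stabilizer Γ x = MulAction.stabilizer Γ (e x) := by
    ext g
    rw [MulAction.mem_stabilizer_iff, MulAction.mem_stabilizer_iff, ← he, e.apply_eq_iff_eq]
  rw [this]

theorem sum_carrier_sum {M : Type*} [AddCommMonoid M] (X Y : FinGSet Γ)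
    (f : (X.sum Y).carrier → M) :
    ∑ x, f x = ∑ x : X.carrier, f (Sum.inl x) + ∑ y : Y.carrier, f (Sum.inr y) :=
  (Fintype.sum_equiv (ι := (X.sum Y).carrier) (κ := X.carrier ⊕ Y.carrier) (Equiv.refl _) f f
    fun _ => rfl).trans
    (Fintype.sum_sum_type f)

theorem stabilizerSum_sum [Finite Γ] (X Y : FinGSet Γ) :
    stabilizerSum (X.sum Y) = stabilizerSum X + stabilizerSum Y := by
  have h1 : ∀ x : X.carrier, MulAction.stabilizer Γ (Sum.inl x : (X.sum Y).carrier) =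
      MulAction.stabilizer Γ x := fun x => by
    ext g
    exact Sum.inl_injective.eq_iff
  have h2 : ∀ y : Y.carrier, MulAction.stabilizer Γ (Sum.inr y : (X.sum Y).carrier) =
      MulAction.stabilizer Γ y := fun x => by
    ext g
    exact Sum.inr_injective.eq_iff
  refine (sum_carrier_sum X Y _).trans ?_
  exact congrArg₂ (· + ·)
    (Finset.sum_congr rfl fun x _ =>
      congrArg (fun S : Subgroup Γ => Nat.card S • mk (FinGSet.coset S)) (h1 x))
    (Finset.sum_congr rfl fun y _ =>
      congrArg (fun S : Subgroup Γ => Nat.card S • mk (FinGSet.coset S)) (h2 y))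

theorem stabilizerSum_coset [Finite Γ] (L : Subgroup Γ) :
    stabilizerSum (FinGSet.coset L) = Nat.card Γ • mk (FinGSet.coset L) := by
  have h : ∀ x : (FinGSet.coset L).carrier,
      mk (FinGSet.coset (MulAction.stabilizer Γ x)) = mk (FinGSet.coset L) := fun x =>
    (mk_eq (FinGSet.iso_coset_of_transitive _ x fun y => MulAction.exists_smul_eq (M := Γ)
      (α := Γ ⧸ L) x y)).symm
  have h' : ∀ x : (FinGSet.coset L).carrier,
      Nat.card (MulAction.stabilizer Γ x) = Nat.card L := fun x => by
    obtain ⟨g, rfl⟩ := MulAction.exists_smul_eq (M := Γ) (α := Γ ⧸ L) (QuotientGroup.mk 1) x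
    refine (Nat.card_congr (MulAction.stabilizerEquivStabilizer (G := Γ) (α := Γ ⧸ L)
      (a := QuotientGroup.mk 1) (b := g • (QuotientGroup.mk 1)) rfl).toEquiv).symm.trans ?_
    rw [MulAction.stabilizer_quotient]
  unfold stabilizerSum
  simp only [h, h']
  rw [Finset.sum_const, smul_smul, Finset.card_univ, ← Nat.card_eq_fintype_card,
    Subgroup.card_eq_card_quotient_mul_card_subgroup L]
  rfl

/-- The decomposition of a finite `Γ`-set into orbits, weighted by stabilizers. -/
theorem card_smul_mk [Finite Γ] (X : FinGSet Γ) : Nat.card Γ • mk X = stabilizerSum X := by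
  have key : ∀ x : GSetClass Γ, Nat.card Γ • x =
      Quotient.lift stabilizerSum (fun _ _ => stabilizerSum_congr) x := by
    refine coset_induction ?_ ?_ ?_
    · rw [smul_zero]
      exact (Finset.sum_eq_zero fun x _ => PEmpty.elim x :
        stabilizerSum (FinGSet.empty Γ) = 0).symm
    · intro x y hX hY
      obtain ⟨X, rfl⟩ : ∃ X, mk X = x := Quotient.exists_rep x
      obtain ⟨Y, rfl⟩ : ∃ Y, mk Y = y := Quotient.exists_rep y
      rw [smul_add, hX, hY]
      exact (stabilizerSum_sum X Y).symm
    · intro L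
      exact (stabilizerSum_coset L).symm
  exact key (mk X)

end GSetClass

/-! ### Vanishing of Möbius-weighted products of transitive sets -/

section Vanishing

variable {Γ G : Type u} [Group Γ] [Group G]

theorem stabilizer_mk (K : Subgroup G) (g : G) :
    MulAction.stabilizer G (QuotientGroup.mk g : G ⧸ K) =
      K.map (MulAut.conj g).toMonoidHom := by
  have := MulAction.stabilizer_smul_eq_stabilizer_map_conj g (QuotientGroup.mk 1 : G ⧸ K)
  rw [MulAction.stabilizer_quotient] at this
  rw [← this]
  congr 1
  exact congrArg QuotientGroup.mk (mul_one g).symm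

/-- Each coset gK has |K| representatives and stabilizer gKg⁻¹. Trading points of G/K for elements
of G makes the index set independent of K, so that a sum over K can be moved inside. -/
theorem card_smul_sum_coset {A : Type*} [AddCommMonoid A] (K : Subgroup G) [Fintype G]
    [Fintype (G ⧸ K)] (h : Subgroup G → A) :
    Nat.card K • ∑ x : G ⧸ K, h (MulAction.stabilizer G x) =
      ∑ g : G, h (K.map (MulAut.conj g).toMonoidHom) := by
  classical
  simp only [← stabilizer_mk]
  rw [← Finset.sum_fiberwise (s := Finset.univ) (g := fun g : G => (QuotientGroup.mk g : G ⧸ K)),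
    Finset.smul_sum]
  refine Finset.sum_congr rfl fun x _ => ?_
  rw [Finset.sum_congr rfl (g := fun _ => h (MulAction.stabilizer G x))
    (fun g hg => by rw [(Finset.mem_filter.1 hg).2]), Finset.sum_const]
  congr 1
  obtain ⟨g, rfl⟩ := QuotientGroup.mk_surjective x
  rw [← Fintype.card_subtype, ← Nat.card_eq_fintype_card]
  refine Nat.card_congr ⟨fun k => ⟨g * k, ?_⟩, fun y => ⟨g⁻¹ * y.1, ?_⟩, ?_, ?_⟩
  · exact (QuotientGroup.mk_mul_of_mem g k.2)
  · exact QuotientGroup.eq.1 y.2.symm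
  · intro k
    simp
  · intro y
    simp

/-- The weighted class of the orbit of a point whose stabilizer is `π⁻¹(J) ∩ S`. -/
noncomputable def orbitTerm [Finite Γ] (π : Γ →* G) (S : Subgroup Γ) (J : Subgroup G) : GSetClass Γ :=
  Nat.card (J.comap π ⊓ S : Subgroup Γ) • GSetClass.mk (FinGSet.coset (J.comap π ⊓ S))

/-- The stabilizer of (x, u) is π⁻¹(G_x) ∩ Γ_u. Summing over points rather than orbits costs the
factor |Γ|, which is invertible in the application. -/
theorem card_smul_mk_res_prod [Finite Γ] (π : Γ →* G) (X : FinGSet G) (U : FinGSet Γ) :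
    Nat.card Γ • GSetClass.mk ((X.res π).prod U) =
      ∑ u : U.carrier, ∑ x : X.carrier,
        orbitTerm π (MulAction.stabilizer Γ u) (MulAction.stabilizer G x) := by
  rw [GSetClass.card_smul_mk, Finset.sum_comm]
  refine Eq.trans ?_ (Fintype.sum_prod_type (fun p : X.carrier × U.carrier =>
    orbitTerm π (MulAction.stabilizer Γ p.2) (MulAction.stabilizer G p.1)))
  refine Fintype.sum_equiv (ι := ((X.res π).prod U).carrier) (κ := X.carrier × U.carrier)
    (Equiv.refl _) _ _ fun p => ?_
  have : MulAction.stabilizer Γ p =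
      (MulAction.stabilizer G (show X.carrier from p.1)).comap π ⊓ MulAction.stabilizer Γ p.2 := by
    ext g
    exact Prod.ext_iff
  rw [this]
  rfl

/-- Intersecting π⁻¹(·) with S only sees the part of the subgroup inside π(S). Thus J enters only
through J ∩ g⁻¹π(S)g, the shape required by `sum_moebius_top_inf`. -/
theorem orbitTerm_map_conj [Finite Γ] (π : Γ →* G) (S : Subgroup Γ) (J : Subgroup G) (g : G) :
    orbitTerm π S ((J ⊓ (S.map π).map (MulAut.conj g⁻¹).toMonoidHom).map
      (MulAut.conj g).toMonoidHom) = orbitTerm π S (J.map (MulAut.conj g).toMonoidHom) := by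
  have : ((J ⊓ (S.map π).map (MulAut.conj g⁻¹).toMonoidHom).map
      (MulAut.conj g).toMonoidHom).comap π ⊓ S =
      (J.map (MulAut.conj g).toMonoidHom).comap π ⊓ S := by
    refine le_antisymm (inf_le_inf_right _ (Subgroup.comap_mono (Subgroup.map_mono inf_le_left)))
      (le_inf ?_ inf_le_right)
    rintro x ⟨⟨j, hj, hjx⟩, hx⟩
    refine ⟨j, ⟨hj, π x, ⟨x, hx, rfl⟩, ?_⟩, hjx⟩
    rw [← hjx]
    simp [mul_assoc]
  unfold orbitTerm
  rw [this]

theorem map_conj_ne_top {H : Subgroup G} (hH : H ≠ ⊤) (g : G) :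
    H.map (MulAut.conj g).toMonoidHom ≠ ⊤ := fun h =>
  hH (by
    rw [← Subgroup.map_top_of_surjective (MulAut.conj g).toMonoidHom
      (MulAut.conj g).surjective] at h
    exact Subgroup.map_injective (MulAut.conj g).injective h)

theorem map_stabilizer_mk_ne_top (π : Γ →* G) {L : Subgroup Γ} (hL : L.map π ≠ ⊤) (u : Γ ⧸ L) :
    (MulAction.stabilizer Γ u).map π ≠ ⊤ := by
  obtain ⟨γ, rfl⟩ := QuotientGroup.mk_surjective u
  have : (L.map (MulAut.conj γ).toMonoidHom).map π =
      (L.map π).map (MulAut.conj (π γ)).toMonoidHom := by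
    rw [Subgroup.map_map, Subgroup.map_map]
    congr 1
    ext x
    simp
  rw [stabilizer_mk, this]
  exact map_conj_ne_top hL _

/-- Multiply by |Γ|, and let the weight |K| turn points of G/K into elements g of G. For fixed u and
g, the K-term depends only on K ∩ g⁻¹π(Γ_u)g; since π(Γ_u) is conjugate to the proper subgroup π(L),
Weisner's theorem makes the sum over K vanish. The map π is left general to serve both projections
of G × G. -/
theorem sum_moebius_res_prod_eq_zero [Finite Γ] [Finite G] {R : Type v} [CommRing R] {A : Type*} [AddCommGroup A]
    [Module R A] (hΓ : IsUnit (Nat.card Γ : R)) (ψ : GSetClass Γ →+ A) (π : Γ →* G)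
    {L : Subgroup Γ} (hL : L.map π ≠ ⊤) (s : Finset (Subgroup G)) (hs : ∀ K, K ∈ s) :
    ∑ K ∈ s, ((Nat.card K : R) * (moebius K ⊤ : R)) •
      ψ (GSetClass.mk (((FinGSet.coset K).res π).prod (FinGSet.coset L))) = 0 := by
  let := Fintype.ofFinite G
  have h1 : ∀ K : Subgroup G, (Nat.card Γ : R) • ((Nat.card K : R) * (moebius K ⊤ : R)) •
      ψ (GSetClass.mk (((FinGSet.coset K).res π).prod (FinGSet.coset L))) =
      ∑ u : (FinGSet.coset L).carrier, ∑ g : G, moebius K ⊤ •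
        ψ (orbitTerm π (MulAction.stabilizer Γ u) (K.map (MulAut.conj g).toMonoidHom)) := by
    intro K
    let := Fintype.ofFinite (G ⧸ K)
    have h2 : ∀ u : (FinGSet.coset L).carrier, Nat.card K • ∑ x : (FinGSet.coset K).carrier,
        orbitTerm π (MulAction.stabilizer Γ u) (MulAction.stabilizer G x) = ∑ g : G,
        orbitTerm π (MulAction.stabilizer Γ u) (K.map (MulAut.conj g).toMonoidHom) := fun u => by
      rw [← card_smul_sum_coset K]
      congr 1
    have h3 := congrArg (fun y => moebius K ⊤ • Nat.card K • ψ y)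
      (card_smul_mk_res_prod π (FinGSet.coset K) (FinGSet.coset L))
    simp only [← map_nsmul, Finset.smul_sum, h2] at h3
    simp only [map_sum, Finset.smul_sum] at h3
    rw [← h3, map_nsmul, map_nsmul, ← Nat.cast_smul_eq_nsmul R (Nat.card K),
      ← Nat.cast_smul_eq_nsmul R (Nat.card Γ), ← Int.cast_smul_eq_zsmul R, smul_smul, smul_smul,
      smul_smul]
    congr 1
    ring
  refine hΓ.smul_eq_zero.1 ?_
  rw [Finset.smul_sum, Finset.sum_congr rfl fun K _ => h1 K,
    Finset.sum_comm]
  refine Finset.sum_eq_zero fun u _ => ?_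
  rw [Finset.sum_comm]
  refine Finset.sum_eq_zero fun g _ => ?_
  rw [← sum_moebius_top_inf s hs
    (map_conj_ne_top (map_stabilizer_mk_ne_top π hL u) g⁻¹)
    fun J => ψ (orbitTerm π (MulAction.stabilizer Γ u) (J.map (MulAut.conj g).toMonoidHom))]
  refine Finset.sum_congr rfl fun K _ => congrArg (fun y => moebius K ⊤ • ψ y) ?_
  exact (orbitTerm_map_conj π _ K g).symm

end Vanishing

/-! ### Bisets as G × G-sets and products of transitive bisets -/

namespace FinBiset

open MulOpposite

variable {G : Type u} [Group G]

/-- The biset attached to a `G × G`-set, with `a · x · b = (a, b⁻¹) x`. -/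
def ofGSet (X : FinGSet (G × G)) : FinBiset G G :=
  ofMaps X.carrier (fun a x => ((a, 1) : G × G) • x) (fun x b => ((1, b⁻¹) : G × G) • x)
    (fun x => one_smul (G × G) x)
    (fun a b x => by rw [smul_smul]; simp)
    (fun x => by rw [inv_one]; exact one_smul (G × G) x)
    (fun x a b => by rw [smul_smul]; simp)
    (fun a x b => by rw [smul_smul, smul_smul]; simp)

/-- The `G × G`-set attached to a biset, with `(a, b) x = a · x · b⁻¹`. -/
def toGSet (U : FinBiset G G) : FinGSet (G × G) where
  carrier := U.carrier
  action :=
    { smul := fun p u => p.1 • op p.2⁻¹ • u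
      one_smul := fun u => by
        change (1 : G) • op (1 : G)⁻¹ • u = u
        simp
      mul_smul := fun p q u => by
        change (p.1 * q.1) • op (p.2 * q.2)⁻¹ • u = p.1 • op p.2⁻¹ • q.1 • op q.2⁻¹ • u
        rw [mul_inv_rev, op_mul, mul_smul, mul_smul, smul_comm q.1 (op p.2⁻¹)] }

theorem iso_ofGSet_toGSet (U : FinBiset G G) : Iso U (ofGSet (toGSet U)) := by
  refine ⟨Equiv.refl _, fun g u => ?_, fun g u => ?_⟩
  · change g • u = g • op (1 : G)⁻¹ • u
    simp
  · change op g • u = (1 : G) • op (g⁻¹)⁻¹ • u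
    simp

theorem ofGSet_congr {X Y : FinGSet (G × G)} (h : FinGSet.Iso X Y) :
    Iso (ofGSet X) (ofGSet Y) := by
  obtain ⟨e, he⟩ := h
  exact ⟨e, fun g x => he _ x, fun g x => he _ x⟩

theorem iso_coset_of_transitive [Finite G] (U : FinBiset G G) (x : U.carrier)
    (hx : ∀ y, ∃ a b : G, a • op b • x = y) (L : Subgroup (G × G))
    (hL : ∀ a b : G, (a, b) ∈ L ↔ a • op b⁻¹ • x = x) : Iso U (coset L) := by
  have h1 := FinGSet.iso_coset_of_transitive U.toGSet x fun y => by
    obtain ⟨a, b, h⟩ := hx y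
    refine ⟨(a, b⁻¹), ?_⟩
    rw [← h]
    exact congrArg (fun c => a • op c • x) (inv_inv b)
  have h2 : MulAction.stabilizer (G × G) (show U.toGSet.carrier from x) = L := by
    ext ⟨a, b⟩
    exact (hL a b).symm
  rw [h2] at h1
  exact iso_equivalence.trans (iso_ofGSet_toGSet U) (ofGSet_congr h1)

/-- The composition of two relations on a group. -/
def relComp (L L' : Subgroup (G × G)) : Subgroup (G × G) where
  carrier := {p | ∃ b, (p.1, b) ∈ L ∧ (b, p.2) ∈ L'}
  one_mem' := ⟨1, L.one_mem, L'.one_mem⟩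
  mul_mem' := by
    rintro p q ⟨b, h, h'⟩ ⟨c, k, k'⟩
    exact ⟨b * c, L.mul_mem h k, L'.mul_mem h' k'⟩
  inv_mem' := by
    rintro p ⟨b, h, h'⟩
    exact ⟨b⁻¹, L.inv_mem h, L'.inv_mem h'⟩

/-- In general the Mackey formula has one summand for each double coset of the second projection of
`L` and the first projection of `L'`. The hypothesis says that there is only one, so the product is
transitive, and the stabilizer of its base point is the relational composite. -/
theorem coset_comp_coset [Finite G] (L L' : Subgroup (G × G))
    (h : ∀ b : G, ∃ a s t c, (a, s) ∈ L ∧ (t, c) ∈ L' ∧ b = s * t) :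
    Iso (comp (coset L) (coset L')) (coset (relComp L L')) := by
  refine iso_coset_of_transitive _
    (pair (U := coset L) (V := coset L') (QuotientGroup.mk 1 : (G × G) ⧸ L)
      (QuotientGroup.mk 1 : (G × G) ⧸ L')) ?_ _ ?_
  · intro y
    refine pair_induction y fun u v => ?_
    obtain ⟨⟨g, k⟩, rfl⟩ := QuotientGroup.mk_surjective (s := L) u
    obtain ⟨⟨g', k'⟩, rfl⟩ := QuotientGroup.mk_surjective (s := L') v
    obtain ⟨a, s, t, c, hs, ht, hst⟩ := h (k⁻¹ * g')
    -- With k⁻¹g' = st, replace (g, k) by (ga, ks) modulo L and move ks across the pair. The second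
    -- entry becomes (t, k'), which is (1, k'c⁻¹) modulo L'.
    refine ⟨g * a, c * k'⁻¹, ?_⟩
    have e1 : (QuotientGroup.mk (g, k) : (G × G) ⧸ L) =
        QuotientGroup.mk (g * a, k * s) := by
      rw [QuotientGroup.eq]
      simpa using hs
    have e2 : (QuotientGroup.mk ((k * s)⁻¹ * g', k') : (G × G) ⧸ L') =
        QuotientGroup.mk (1, k' * c⁻¹) := by
      rw [QuotientGroup.eq]
      have : g' = k * (s * t) := by rw [← hst]; group
      rw [this]
      simpa [mul_assoc] using L'.inv_mem ht
    have e3 := pair_op_smul (U := coset L) (V := coset L') (k * s)⁻¹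
      (QuotientGroup.mk (g * a, 1) : (G × G) ⧸ L) (QuotientGroup.mk (g', k') : (G × G) ⧸ L')
    have e4 : ((QuotientGroup.mk (g, k) : (G × G) ⧸ L) : (coset L).carrier) =
        op (k * s)⁻¹ • (show (coset L).carrier from (QuotientGroup.mk (g * a, 1) : (G × G) ⧸ L)) := by
      rw [e1]
      change _ = (QuotientGroup.mk (1 * (g * a), ((k * s)⁻¹)⁻¹ * 1) : (G × G) ⧸ L)
      simp
    have e5 : ((k * s)⁻¹ • (show (coset L').carrier from
        (QuotientGroup.mk (g', k') : (G × G) ⧸ L')) : (coset L').carrier) =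
        (QuotientGroup.mk (1, k' * c⁻¹) : (G × G) ⧸ L') := by
      rw [← e2]
      change (QuotientGroup.mk ((k * s)⁻¹ * g', 1 * k') : (G × G) ⧸ L') = _
      simp
    refine Eq.trans ?_ ((congrArg (fun z => (pair z _ : CompCarrier (coset L) (coset L'))) e4).trans
      (e3.trans (congrArg (fun z => (pair _ z : CompCarrier (coset L) (coset L'))) e5))).symm
    change (pair (U := coset L) (V := coset L')
      (QuotientGroup.mk ((g * a) * 1, 1 * 1) : (G × G) ⧸ L)
      (QuotientGroup.mk (1 * 1, (c * k'⁻¹)⁻¹ * 1) : (G × G) ⧸ L')) = _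
    simp
  · intro a b
    have e : a • op b⁻¹ • (show (comp (coset L) (coset L')).carrier from
        pair (U := coset L) (V := coset L') (QuotientGroup.mk 1 : (G × G) ⧸ L)
          (QuotientGroup.mk 1 : (G × G) ⧸ L')) =
        (pair (U := coset L) (V := coset L') (QuotientGroup.mk (a, 1) : (G × G) ⧸ L)
          (QuotientGroup.mk (1, b) : (G × G) ⧸ L')) := by
      change (pair (U := coset L) (V := coset L')
        (QuotientGroup.mk (a * 1, 1 * 1) : (G × G) ⧸ L)
        (QuotientGroup.mk (1 * 1, (b⁻¹)⁻¹ * 1) : (G × G) ⧸ L')) = _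
      simp
    rw [e]
    have e' : ∀ x : G, ((QuotientGroup.mk 1 : (G × G) ⧸ L) =
        QuotientGroup.mk (1 * a, x⁻¹ * 1) ↔ (a, x⁻¹) ∈ L) := fun x => by
      rw [QuotientGroup.eq]; simp
    have e'' : ∀ x : G, ((QuotientGroup.mk 1 : (G × G) ⧸ L') =
        QuotientGroup.mk (x⁻¹ * 1, 1 * b) ↔ (x⁻¹, b) ∈ L') := fun x => by
      rw [QuotientGroup.eq]; simp
    constructor
    · rintro ⟨c, h1, h2⟩
      refine Quotient.sound (s := compSetoid (coset L) (coset L')) ⟨c⁻¹, Prod.ext ?_ ?_⟩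
      · exact (e' c⁻¹).2 (by simpa using h1)
      · exact (e'' c⁻¹).2 (by simpa using h2)
    · intro hq
      obtain ⟨c, hc⟩ := Quotient.exact (s := compSetoid (coset L) (coset L')) hq
      exact ⟨c⁻¹, (e' c).1 (congrArg Prod.fst hc), (e'' c).1 (congrArg Prod.snd hc)⟩

/-- The diagonal copy of a subgroup `K` in `G × G`. -/
def diagSubgroup (K : Subgroup G) : Subgroup (G × G) :=
  K.map (MonoidHom.prod (MonoidHom.id G) (MonoidHom.id G))

theorem mem_diagSubgroup {K : Subgroup G} {a b : G} : (a, b) ∈ diagSubgroup K ↔ a = b ∧ a ∈ K := by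
  constructor
  · rintro ⟨x, hx, h⟩
    obtain ⟨rfl, rfl⟩ := Prod.ext_iff.1 h
    exact ⟨rfl, hx⟩
  · rintro ⟨rfl, h⟩
    exact ⟨a, h, rfl⟩

theorem tilde_coset [Finite G] (K : Subgroup G) :
    Iso (tilde (FinGSet.coset K)) (coset (diagSubgroup K)) := by
  refine iso_coset_of_transitive (tilde (FinGSet.coset K))
    ((1, QuotientGroup.mk 1) : G × (G ⧸ K)) ?_ _ ?_
  · rintro ⟨g, x⟩
    obtain ⟨k, rfl⟩ := QuotientGroup.mk_surjective (s := K) x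
    refine ⟨k, k⁻¹ * g, ?_⟩
    change ((k * (1 * (k⁻¹ * g)), QuotientGroup.mk (k * 1)) : G × (G ⧸ K)) = _
    simp
    rfl
  · intro a b
    rw [mem_diagSubgroup]
    change _ ↔ ((a * (1 * b⁻¹), QuotientGroup.mk (a * 1)) : G × (G ⧸ K)) = _
    rw [Prod.ext_iff]
    refine and_congr ?_ ?_
    · simp [mul_inv_eq_one]
    · change _ ↔ (QuotientGroup.mk (a * 1) : G ⧸ K) = QuotientGroup.mk 1
      rw [eq_comm, QuotientGroup.eq]
      simp

/-- Balancing over G absorbs the free factor of `tilde X`: each class has a unique representative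
with G-coordinate 1. Left multiplication by `tilde X` thus becomes a cartesian product, to which the
vanishing statement for Γ-sets applies. -/
theorem tilde_comp [Finite G] (X : FinGSet G) (V : FinGSet (G × G)) :
    Iso (comp (tilde X) (ofGSet V)) (ofGSet ((X.res (MonoidHom.fst G G)).prod V)) := by
  refine ⟨⟨compLift (U := tilde X) (V := ofGSet V) (T := X.carrier × V.carrier)
      (fun p v => ((show G × X.carrier from p).2,
        (((show G × X.carrier from p).1, 1) : G × G) • (show V.carrier from v))) ?_,
    fun q => pair (U := tilde X) (V := ofGSet V) ((1, q.1) : G × X.carrier) q.2, ?_, ?_⟩, ?_, ?_⟩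
  · rintro h ⟨g, x⟩ v
    change ((x, ((g * h, 1) : G × G) • (show V.carrier from v)) : X.carrier × V.carrier) =
      (x, ((g, 1) : G × G) • ((h, 1) : G × G) • (show V.carrier from v))
    rw [smul_smul]
    simp
  · intro y
    refine pair_induction y ?_
    rintro ⟨g, x⟩ v
    refine (pair_op_smul (U := tilde X) (V := ofGSet V) g ((1, x) : G × X.carrier) v).symm.trans ?_
    exact congrArg (fun z => (pair (U := tilde X) (V := ofGSet V) ((z, x) : G × X.carrier) v))
      (one_mul g)
  · rintro ⟨x, v⟩
    exact Prod.ext rfl (one_smul (G × G) v)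
  · intro a y
    refine pair_induction y ?_
    rintro ⟨g, x⟩ v
    refine Prod.ext rfl ?_
    change ((a * g, 1) : G × G) • (show V.carrier from v) =
      ((a, 1) : G × G) • ((g, 1) : G × G) • (show V.carrier from v)
    rw [smul_smul]
    simp
  · intro b y
    refine pair_induction y ?_
    rintro ⟨g, x⟩ v
    refine Prod.ext (one_smul G x).symm ?_
    change ((g, 1) : G × G) • ((1, b⁻¹) : G × G) • (show V.carrier from v) =
      ((1, b⁻¹) : G × G) • ((g, 1) : G × G) • (show V.carrier from v)
    rw [smul_smul, smul_smul]
    simp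

/-- Here (g, x) = g · (1, g⁻¹x), because the left action moves both coordinates of `tilde X`; this
is the source of the twist g⁻¹x, absent from `tilde_comp`. -/
theorem comp_tilde [Finite G] (X : FinGSet G) (V : FinGSet (G × G)) :
    Iso (comp (ofGSet V) (tilde X)) (ofGSet ((X.res (MonoidHom.snd G G)).prod V)) := by
  refine ⟨⟨compLift (U := ofGSet V) (V := tilde X) (T := X.carrier × V.carrier)
      (fun v p => ((show G × X.carrier from p).1⁻¹ • (show G × X.carrier from p).2,
        ((1, (show G × X.carrier from p).1⁻¹) : G × G) • (show V.carrier from v))) ?_,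
    fun q => pair (U := ofGSet V) (V := tilde X) q.2 ((1, q.1) : G × X.carrier), ?_, ?_⟩, ?_, ?_⟩
  · rintro h v ⟨g, x⟩
    change ((g⁻¹ • x, ((1, g⁻¹) : G × G) • ((1, h⁻¹) : G × G) • (show V.carrier from v)) :
      X.carrier × V.carrier) =
      ((h * g)⁻¹ • h • x, ((1, (h * g)⁻¹) : G × G) • (show V.carrier from v))
    rw [smul_smul, smul_smul]
    simp
  · intro y
    refine pair_induction y ?_
    rintro v ⟨g, x⟩
    have := pair_op_smul (U := ofGSet V) (V := tilde X) g v ((1, g⁻¹ • x) : G × X.carrier)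
    refine Eq.trans this ?_
    refine congrArg (fun z => (pair (U := ofGSet V) (V := tilde X) v z)) ?_
    exact Prod.ext (mul_one g) (smul_inv_smul g (show X.carrier from x))
  · rintro ⟨x, v⟩
    refine Prod.ext ?_ ?_
    · change (1 : G)⁻¹ • (show X.carrier from x) = x
      rw [inv_one]
      exact one_smul G (show X.carrier from x)
    · change ((1, (1 : G)⁻¹) : G × G) • v = v
      rw [inv_one]
      exact one_smul (G × G) v
  · intro a y
    refine pair_induction y ?_
    rintro v ⟨g, x⟩
    refine Prod.ext (one_smul G (show X.carrier from g⁻¹ • x)).symm ?_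
    change ((1, g⁻¹) : G × G) • ((a, 1) : G × G) • (show V.carrier from v) =
      ((a, 1) : G × G) • ((1, g⁻¹) : G × G) • (show V.carrier from v)
    rw [smul_smul, smul_smul]
    simp
  · intro b y
    refine pair_induction y ?_
    rintro v ⟨g, x⟩
    refine Prod.ext ?_ ?_
    · change (g * b)⁻¹ • x = b⁻¹ • g⁻¹ • x
      rw [mul_inv_rev, mul_smul]
    · change ((1, (g * b)⁻¹) : G × G) • (show V.carrier from v) =
        ((1, b⁻¹) : G × G) • ((1, g⁻¹) : G × G) • (show V.carrier from v)
      rw [smul_smul]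
      simp

end FinBiset

/-! ### Transitive bisets generate -/

namespace BisetClass

variable {G : Type u} [Group G]

theorem mk_eq {U V : FinBiset G G} (h : FinBiset.Iso U V) : mk U = mk V := Quotient.sound h

/-- The additive map from isomorphism classes of `G × G`-sets to isomorphism classes of bisets. -/
def ofGSetHom [Finite G] : GSetClass (G × G) →+ BisetClass G G where
  toFun := Quotient.map FinBiset.ofGSet fun _ _ => FinBiset.ofGSet_congr
  map_zero' := Quotient.sound ⟨Equiv.refl _, fun _ x => x.elim, fun _ x => x.elim⟩
  map_add' := by
    rintro ⟨X⟩ ⟨Y⟩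
    refine Quotient.sound ⟨Equiv.refl _, ?_, ?_⟩ <;> rintro g (x | x) <;> rfl

theorem ofGSetHom_mk [Finite G] (X : FinGSet (G × G)) :
    ofGSetHom (GSetClass.mk X) = mk (FinBiset.ofGSet X) := rfl

theorem ofGSetHom_coset [Finite G] (L : Subgroup (G × G)) :
    ofGSetHom (GSetClass.mk (FinGSet.coset L)) = mk (FinBiset.coset L) := rfl

/-- Every finite biset is a disjoint union of transitive bisets. -/
theorem coset_induction [Finite G] {p : BisetClass G G → Prop} (h0 : p 0)
    (hadd : ∀ x y, p x → p y → p (x + y)) (hc : ∀ L : Subgroup (G × G), p (mk (FinBiset.coset L)))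
    (x : BisetClass G G) : p x := by
  obtain ⟨U, rfl⟩ : ∃ U, mk U = x := Quotient.exists_rep x
  rw [mk_eq U.iso_ofGSet_toGSet, ← ofGSetHom_mk]
  refine GSetClass.coset_induction (p := fun y => p (ofGSetHom y)) ?_ ?_ ?_ _
  · rw [map_zero]
    exact h0
  · intro y z hy hz
    rw [map_add]
    exact hadd _ _ hy hz
  · intro L
    rw [ofGSetHom_coset]
    exact hc L

end BisetClass

/-! ### Frattini subgroups of nilpotent groups and subdirect relations -/

section Frattini

variable {G : Type u} [Group G]

theorem isSimpleGroup_quotient_of_isCoatom {M : Subgroup G} [M.Normal] (hM : IsCoatom M) :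
    IsSimpleGroup (G ⧸ M) := by
  have : Nontrivial (G ⧸ M) := by
    rw [← not_subsingleton_iff_nontrivial]
    exact fun h => hM.1 (QuotientGroup.subsingleton_iff.1 h)
  refine ⟨fun H _ => ?_⟩
  have h : M ≤ H.comap (QuotientGroup.mk' M) := fun x hx => by
    rw [Subgroup.mem_comap, QuotientGroup.mk'_apply, (QuotientGroup.eq_one_iff x).2 hx]
    exact H.one_mem
  have hs := QuotientGroup.mk'_surjective M
  rcases hM.le_iff.1 h with h | h
  · right
    exact Subgroup.comap_injective hs (h.trans (Subgroup.comap_top _).symm)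
  · left
    refine Subgroup.comap_injective hs (h.trans ?_)
    rw [MonoidHom.comap_bot, QuotientGroup.ker_mk']

theorem normal_of_isCoatom [Finite G] (hG : Group.IsNilpotent G) {M : Subgroup G} (hM : IsCoatom M) :
    M.Normal := by
  have h : Group.IsNilpotent G ↔ ∀ H : Subgroup G, IsCoatom H → H.Normal :=
    Group.isNilpotent_of_finite_tfae.out 0 2
  exact h.1 hG M hM

theorem isMulCommutative_quotient_of_isCoatom (hG : Group.IsNilpotent G) {M : Subgroup G}
    [M.Normal] (hM : IsCoatom M) : IsMulCommutative (G ⧸ M) := by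
  have := isSimpleGroup_quotient_of_isCoatom hM
  exact ⟨⟨IsSimpleGroup.comm_iff_isSolvable.2 inferInstance⟩⟩

theorem prime_index_of_isCoatom [Finite G] (hG : Group.IsNilpotent G) {M : Subgroup G} (hM : IsCoatom M) :
    M.index.Prime := by
  have := normal_of_isCoatom hG hM
  have := isMulCommutative_quotient_of_isCoatom hG hM
  exact Group.is_simple_iff_prime_card.1 (isSimpleGroup_quotient_of_isCoatom hM)

theorem mem_frattini_iff {x : G} : x ∈ frattini G ↔ ∀ M : Subgroup G, IsCoatom M → x ∈ M := by
  simp [frattini, Order.radical, Subgroup.mem_iInf]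

theorem commutator_le_frattini [Finite G] (hG : Group.IsNilpotent G) : commutator G ≤ frattini G := by
  intro x hx
  rw [mem_frattini_iff]
  intro M hM
  have := normal_of_isCoatom hG hM
  have := isMulCommutative_quotient_of_isCoatom hG hM
  exact Subgroup.Normal.quotient_commutative_iff_commutator_le.1 inferInstance hx

/-- Maximal subgroups are normal of prime index, and a prime dividing p^a m already divides pm. It
is applied with m prime to p, to control p-parts modulo Φ. -/
theorem pow_mem_frattini [Finite G] (hG : Group.IsNilpotent G) {p m : ℕ}
    (h : ∃ a, Nat.card G = p ^ a * m) (x : G) : x ^ (p * m) ∈ frattini G := by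
  obtain ⟨a, ha⟩ := h
  rw [mem_frattini_iff]
  intro M hM
  have := normal_of_isCoatom hG hM
  have hq := prime_index_of_isCoatom hG hM
  have h1 : M.index ∣ p ^ a * m := ha ▸ M.index_dvd_card
  have h2 : M.index ∣ p * m := by
    rcases hq.dvd_mul.1 h1 with h | h
    · exact (hq.dvd_of_dvd_pow h).mul_right m
    · exact h.mul_left p
  obtain ⟨k, hk⟩ := h2
  rw [hk, pow_mul]
  exact M.pow_mem (Subgroup.pow_index_mem M x) k

theorem normal_of_frattini_le [Finite G] (hG : Group.IsNilpotent G) {H : Subgroup G} (hH : frattini G ≤ H) :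
    H.Normal :=
  ⟨fun h hh g => by
    have h1 : g * h * g⁻¹ * h⁻¹ ∈ H := hH (commutator_le_frattini hG (Subgroup.commutator_mem_commutator
      (Subgroup.mem_top g) (Subgroup.mem_top h)))
    have h2 := H.mul_mem h1 hh
    rwa [inv_mul_cancel_right] at h2⟩

/-- In a finite nilpotent group the Frattini subgroup of a quotient is the image of the Frattini
subgroup. -/
theorem exists_isCoatom_of_notMem_frattini_sup [Finite G] (hG : Group.IsNilpotent G) (N : Subgroup G) {x : G}
    (hx : x ∉ frattini G ⊔ N) : ∃ H : Subgroup G, IsCoatom H ∧ N ≤ H ∧ x ∉ H := by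
  -- Take H above ΦN, maximal among subgroups that omit x. It is normal since it contains Φ, and the
  -- rest of the proof shows that it is a maximal subgroup.
  obtain ⟨H, hle, hH⟩ := Finite.exists_le_maximal (p := fun H : Subgroup G => x ∉ H) hx
  have hΦ : frattini G ≤ H := le_sup_left.trans hle
  have := normal_of_frattini_le hG hΦ
  have hxH : x ∉ H := hH.prop
  let q := QuotientGroup.mk' H
  have hq : ∀ y, q y = 1 ↔ y ∈ H := fun y => QuotientGroup.eq_one_iff y
  -- Every subgroup strictly above H contains x, so the image of x in G/H is a power of each
  -- nontrivial element.
  have key : ∀ y, y ∉ H → ∃ k : ℤ, q x = q y ^ k := by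
    intro y hy
    have h1 : x ∈ H ⊔ Subgroup.zpowers y := by
      by_contra h
      exact hy (hH.le_of_ge h le_sup_left
        ((le_sup_right : _ ≤ H ⊔ Subgroup.zpowers y) (Subgroup.mem_zpowers y)))
    obtain ⟨h, hh, _, ⟨k, rfl⟩, rfl⟩ := Subgroup.mem_sup_of_normal_left.1 h1
    exact ⟨k, by rw [map_mul, (hq h).2 hh, one_mul]; exact map_zpow q y k⟩
  have hqx : q x ≠ 1 := fun h => hxH ((hq x).1 h)
  have ho : orderOf (q x) ≠ 1 := fun h => hqx (orderOf_eq_one_iff.1 h)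
  obtain ⟨p, hp, hpo⟩ := Nat.exists_prime_and_dvd ho
  have := Fact.mk hp
  -- Otherwise the image of x would be a power of its own p-th power, forcing p, a divisor of its
  -- order, to divide 1.
  have h1 : q x ^ p = 1 := by
    by_contra h
    obtain ⟨k, hk⟩ := key (x ^ p) fun h' => h (by rw [← map_pow]; exact (hq _).2 h')
    have h2 : q x ^ ((1 : ℤ) - p * k) = 1 := by
      rw [zpow_sub, zpow_one, zpow_mul, zpow_natCast, ← map_pow, ← hk, mul_inv_cancel]
    have h3 : (p : ℤ) ∣ 1 - p * k :=
      (Int.natCast_dvd_natCast.2 hpo).trans (orderOf_dvd_iff_zpow_eq_one.2 h2)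
    have h4 : (p : ℤ) ∣ 1 := (Int.dvd_iff_dvd_of_dvd_sub h3).2 (dvd_mul_right _ _)
    exact hp.one_lt.ne' (by exact_mod_cast Int.eq_one_of_dvd_one (by positivity) h4)
  obtain ⟨a, m, hm, hG'⟩ := Nat.exists_eq_pow_mul_and_not_dvd (n := Nat.card G)
    Nat.card_pos.ne' p hp.ne_one
  -- G/H has exponent p: if the p-th power of the image of y were nontrivial, the image of x would
  -- be a power of it, hence killed by m because y^(pm) ∈ Φ ≤ H. But its order is divisible by p,
  -- and p does not divide m.
  have h5 : ∀ y, q y ^ p = 1 := by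
    intro y
    by_contra h
    obtain ⟨k, hk⟩ := key (y ^ p) fun h' => h (by rw [← map_pow]; exact (hq _).2 h')
    have h6 : q x ^ m = 1 := by
      rw [hk, ← zpow_natCast, ← zpow_mul, mul_comm, zpow_mul, zpow_natCast, ← map_pow, ← pow_mul,
        (hq _).2 (hΦ (pow_mem_frattini hG ⟨a, hG'⟩ y)), one_zpow]
    exact hm (hpo.trans (orderOf_dvd_of_pow_eq_one h6))
  refine ⟨H, ⟨fun h => hxH (h ▸ Subgroup.mem_top x), fun K hK => ?_⟩, le_sup_right.trans hle, hxH⟩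
  have hxK : x ∈ K := by
    by_contra h
    exact hK.not_ge (hH.le_of_ge h hK.le)
  rw [eq_top_iff]
  intro y _
  by_cases hy : y ∈ H
  · exact hK.le hy
  obtain ⟨k, hk⟩ := key y hy
  have hoy : orderOf (q y) = p := orderOf_eq_prime (h5 y) fun h => hy ((hq y).1 h)
  have hpk : ¬ (p : ℤ) ∣ k := fun h => hqx (by
    rw [hk]; exact orderOf_dvd_iff_zpow_eq_one.1 (hoy ▸ h))
  -- The exponent k is prime to the order p of `q y`, so `q x` generates the same cyclic subgroup as
  -- `q y`; thus G/H is generated by `q x`.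
  have h7 : q y ∈ Subgroup.zpowers (q x) := by
    rw [hk, mem_zpowers_zpow_iff, hoy, Int.gcd_comm]
    exact Int.isCoprime_iff_gcd_eq_one.1 ((Nat.prime_iff_prime_int.1 hp).coprime_iff_not_dvd.2 hpk)
  obtain ⟨j, hj⟩ := h7
  have h8 : (x ^ j)⁻¹ * y ∈ H := by
    rw [← hq, map_mul, map_inv, map_zpow]
    exact inv_mul_eq_one.2 hj
  have h9 := K.mul_mem (K.zpow_mem hxK j) (hK.le h8)
  rwa [mul_inv_cancel_left] at h9

/-- A subgroup of `G × G` with surjective projections. -/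
def IsSubdirect (L : Subgroup (G × G)) : Prop :=
  (∀ a, ∃ b, (a, b) ∈ L) ∧ ∀ b, ∃ a, (a, b) ∈ L

/-- The opposite relation. -/
def relOp (L : Subgroup (G × G)) : Subgroup (G × G) :=
  L.comap (MulEquiv.prodComm : G × G ≃* G × G).toMonoidHom

theorem mem_relOp {L : Subgroup (G × G)} {a b : G} : (a, b) ∈ relOp L ↔ (b, a) ∈ L := Iff.rfl

theorem IsSubdirect.relOp {L : Subgroup (G × G)} (hL : IsSubdirect L) : IsSubdirect (relOp L) :=
  ⟨hL.2, hL.1⟩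

theorem IsSubdirect.normal_goursatFst {L : Subgroup (G × G)} (hL : IsSubdirect L) :
    L.goursatFst.Normal :=
  Subgroup.normal_goursatFst fun a => (hL.1 a).elim fun b h => ⟨⟨(a, b), h⟩, rfl⟩

theorem IsSubdirect.normal_goursatSnd {L : Subgroup (G × G)} (hL : IsSubdirect L) :
    L.goursatSnd.Normal :=
  Subgroup.normal_goursatSnd fun b => (hL.2 b).elim fun a h => ⟨⟨(a, b), h⟩, rfl⟩

/-- Under G/k₁ ≅ G/k₂ maximal subgroups correspond. If b were outside Φk₂, some maximal H ≥ k₂ would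
omit b; its L-preimage H' would be maximal and omit a, contrary to a ∈ Φ. -/
theorem IsSubdirect.mem_frattini_sup [Finite G] (hG : Group.IsNilpotent G) {L : Subgroup (G × G)}
    (hL : IsSubdirect L) {a b : G} (hab : (a, b) ∈ L) (ha : a ∈ frattini G) :
    b ∈ frattini G ⊔ L.goursatSnd := by
  by_contra hb
  obtain ⟨H, hH, hN, hbH⟩ := exists_isCoatom_of_notMem_frattini_sup hG _ hb
  -- Two partners of the same element differ by an element of k₂ ≤ H, so membership in H does not
  -- depend on the partner.
  have hk : ∀ {a b b' : G}, (a, b) ∈ L → (a, b') ∈ L → b ∈ H → b' ∈ H := by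
    intro a b b' h h' hbH
    have : b⁻¹ * b' ∈ H := hN (Subgroup.mem_goursatSnd.2 (by
      simpa using L.mul_mem (L.inv_mem h) h'))
    simpa using H.mul_mem hbH this
  let H' : Subgroup G := (L ⊓ H.comap (MonoidHom.snd G G)).map (MonoidHom.fst G G)
  have hH' : ∀ a, a ∈ H' ↔ ∃ b ∈ H, (a, b) ∈ L := fun a =>
    ⟨by rintro ⟨⟨a, b⟩, ⟨h1, h2⟩, rfl⟩; exact ⟨b, h2, h1⟩,
      by rintro ⟨b, h1, h2⟩; exact ⟨(a, b), ⟨h2, h1⟩, rfl⟩⟩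
  have haH' : a ∉ H' := fun h => by
    obtain ⟨b', hb', h'⟩ := (hH' a).1 h
    exact hbH (hk h' hab hb')
  have hc : IsCoatom H' := by
    refine ⟨fun h => haH' (h ▸ Subgroup.mem_top a), fun J hJ => ?_⟩
    let J' : Subgroup G := (L ⊓ J.comap (MonoidHom.fst G G)).map (MonoidHom.snd G G)
    have hJ' : ∀ b, b ∈ J' ↔ ∃ a ∈ J, (a, b) ∈ L := fun b =>
      ⟨by rintro ⟨⟨a, b⟩, ⟨h1, h2⟩, rfl⟩; exact ⟨a, h2, h1⟩,
        by rintro ⟨a, h1, h2⟩; exact ⟨(a, b), ⟨h2, h1⟩, rfl⟩⟩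
    obtain ⟨j, hj, hjH⟩ := SetLike.exists_of_lt hJ
    have h1 : H < J' := by
      refine SetLike.lt_iff_le_and_exists.2 ⟨fun h hh => ?_, ?_⟩
      · obtain ⟨c, hc⟩ := hL.2 h
        exact (hJ' h).2 ⟨c, hJ.le ((hH' c).2 ⟨h, hh, hc⟩), hc⟩
      · obtain ⟨c, hc⟩ := hL.1 j
        exact ⟨c, (hJ' c).2 ⟨j, hj, hc⟩, fun h => hjH ((hH' j).2 ⟨c, h, hc⟩)⟩
    have h2 := hH.2 _ h1
    rw [eq_top_iff]
    intro g _
    obtain ⟨c, hc⟩ := hL.1 g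
    obtain ⟨d, hd, hdc⟩ := (hJ' c).1 (h2 ▸ Subgroup.mem_top c)
    have h3 : g * d⁻¹ ∈ H' := (hH' _).2 ⟨1, H.one_mem, by
      simpa using L.mul_mem hc (L.inv_mem hdc)⟩
    have h4 := J.mul_mem (hJ.le h3) hd
    rwa [inv_mul_cancel_right] at h4
  exact haH' (mem_frattini_iff.1 ha _ hc)

/-- Any partner of a has the form ck with c ∈ Φ and k ∈ k₂, and (1, k) ∈ L can be divided out. -/
theorem IsSubdirect.exists_mem_frattini [Finite G] (hG : Group.IsNilpotent G) {L : Subgroup (G × G)}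
    (hL : IsSubdirect L) {a : G} (ha : a ∈ frattini G) : ∃ b ∈ frattini G, (a, b) ∈ L := by
  obtain ⟨b, hb⟩ := hL.1 a
  have := hL.normal_goursatSnd
  obtain ⟨c, hc, k, hk, rfl⟩ := Subgroup.mem_sup_of_normal_right.1 (hL.mem_frattini_sup hG hb ha)
  refine ⟨c, hc, ?_⟩
  simpa using L.mul_mem hb (L.inv_mem (Subgroup.mem_goursatSnd.1 hk))

/-- The first projection maps L ∩ (N × N) onto N with kernel 1 × (k₂ ∩ N). -/
theorem card_inf_prod_self [Finite G] {L : Subgroup (G × G)} {N : Subgroup G}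
    (h : ∀ a ∈ N, ∃ b ∈ N, (a, b) ∈ L) :
    Nat.card (L ⊓ N.prod N : Subgroup (G × G)) =
      Nat.card (L.goursatSnd ⊓ N : Subgroup G) * Nat.card N := by
  let f : (L ⊓ N.prod N : Subgroup (G × G)) →* G :=
    (MonoidHom.fst G G).comp (L ⊓ N.prod N).subtype
  have h1 : f.range = N := by
    ext a
    constructor
    · rintro ⟨⟨p, hp⟩, rfl⟩
      exact hp.2.1
    · intro ha
      obtain ⟨b, hb, hab⟩ := h a ha
      exact ⟨⟨(a, b), hab, ha, hb⟩, rfl⟩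
  rw [← f.ker.card_mul_index, Subgroup.index_ker, h1]
  congr 1
  refine Nat.card_congr ⟨fun x => ⟨x.1.1.2, ?_, x.1.2.2.2⟩,
    fun b => ⟨⟨(1, b.1), Subgroup.mem_goursatSnd.1 b.2.1, N.one_mem, b.2.2⟩, rfl⟩, ?_, ?_⟩
  · have hx : x.1.1.1 = 1 := x.2
    have := x.1.2.1
    refine Subgroup.mem_goursatSnd.2 ?_
    rw [← hx]
    exact this
  · rintro ⟨⟨⟨a, b⟩, hab⟩, h⟩
    have : a = 1 := h
    subst this
    rfl
  · intro b
    rfl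

/-- Count L ∩ (Φ × Φ) along both projections, using the opposite relation for the second, and cancel
|Φ|. -/
theorem IsSubdirect.card_goursat_inf_frattini [Finite G] (hG : Group.IsNilpotent G) {L : Subgroup (G × G)}
    (hL : IsSubdirect L) : Nat.card (L.goursatFst ⊓ frattini G : Subgroup G) =
      Nat.card (L.goursatSnd ⊓ frattini G : Subgroup G) := by
  have h1 := card_inf_prod_self fun a ha => hL.exists_mem_frattini hG (a := a) ha
  have h2 := card_inf_prod_self fun a ha => hL.relOp.exists_mem_frattini hG (a := a) ha
  have h3 : (DoubleBurnside.relOp L).goursatSnd = L.goursatFst := by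
    ext x
    rw [Subgroup.mem_goursatSnd, Subgroup.mem_goursatFst, mem_relOp]
  have h4 : Nat.card (L ⊓ (frattini G).prod (frattini G) : Subgroup (G × G)) =
      Nat.card (DoubleBurnside.relOp L ⊓ (frattini G).prod (frattini G) : Subgroup (G × G)) :=
    Nat.card_congr ((Equiv.prodComm G G).subtypeEquiv fun p =>
      ⟨fun h => ⟨h.1, h.2.2, h.2.1⟩, fun h => ⟨h.1, h.2.2, h.2.1⟩⟩)
  rw [h1, h2, h3] at h4
  exact (Nat.eq_of_mul_eq_mul_right Nat.card_pos h4).symm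

end Frattini

open FinBiset (relComp diagSubgroup mem_diagSubgroup)

/-! ### Transitive bisets and the classes of G/M in the double Burnside algebra -/

section Algebra

variable (R : Type v) [CommRing R] {G : Type u} [Group G]

theorem mem_deltaSubgroup {M : NormalSubgroup G} {a b : G} :
    (a, b) ∈ deltaSubgroup M ↔ a * b⁻¹ ∈ M.1 := Iff.rfl

theorem isSubdirect_deltaSubgroup (M : NormalSubgroup G) : IsSubdirect (deltaSubgroup M) :=
  ⟨fun a => ⟨a, by simp [mem_deltaSubgroup]⟩, fun a => ⟨a, by simp [mem_deltaSubgroup]⟩⟩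

theorem IsSubdirect.relComp {L L' : Subgroup (G × G)} (hL : IsSubdirect L)
    (hL' : IsSubdirect L') : IsSubdirect (relComp L L') := by
  refine ⟨fun a => ?_, fun c => ?_⟩
  · obtain ⟨b, hb⟩ := hL.1 a
    obtain ⟨c, hc⟩ := hL'.1 b
    exact ⟨c, b, hb, hc⟩
  · obtain ⟨b, hb⟩ := hL'.2 c
    obtain ⟨a, ha⟩ := hL.2 b
    exact ⟨a, b, ha, hb⟩

theorem NormalSubgroup.join_comm (M N : NormalSubgroup G) : M.join N = N.join M :=
  Subtype.ext (sup_comm _ _)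

variable [Finite G]

/-- The class of a biset in the double Burnside algebra. -/
noncomputable def classHom : BisetClass G G →+ DoubleBurnsideAlgebra R G :=
  ((TensorProduct.mk ℤ R (DoubleBurnsideRing G) 1).toAddMonoidHom).comp
    (GrothendieckRing.of (BisetClass G G))

theorem bisetCoset_eq (L : Subgroup (G × G)) :
    bisetCoset R L = classHom R (BisetClass.mk (FinBiset.coset L)) := rfl

theorem classHom_mk_mul (U V : FinBiset G G) :
    classHom R (BisetClass.mk U) * classHom R (BisetClass.mk V) =
      classHom R (BisetClass.mk (FinBiset.comp U V)) := by
  change ((1 : R) ⊗ₜ[ℤ] _) * ((1 : R) ⊗ₜ[ℤ] _) = (1 : R) ⊗ₜ[ℤ] _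
  rw [Algebra.TensorProduct.tmul_mul_tmul, mul_one, ← GrothendieckRing.of_mul]
  rfl

theorem span_range_bisetCoset :
    Submodule.span R (Set.range (bisetCoset R (G := G))) = ⊤ := by
  rw [eq_top_iff]
  intro x _
  have h : ∀ y : BisetClass G G,
      classHom R y ∈ Submodule.span R (Set.range (bisetCoset R (G := G))) := by
    refine BisetClass.coset_induction ?_ ?_ ?_
    · rw [map_zero]
      exact Submodule.zero_mem _
    · intro y z hy hz
      rw [map_add]
      exact Submodule.add_mem _ hy hz
    · intro L
      exact Submodule.subset_span ⟨L, rfl⟩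
  induction x using TensorProduct.induction_on with
  | zero => exact Submodule.zero_mem _
  | add y z hy hz => exact Submodule.add_mem _ (hy trivial) (hz trivial)
  | tmul r b =>
    induction b using GrothendieckRing.induction with
    | h y z =>
      have : r ⊗ₜ[ℤ] (GrothendieckRing.of (BisetClass G G) y -
          GrothendieckRing.of (BisetClass G G) z) = r • (classHom R y - classHom R z) := by
        change _ = r • ((1 : R) ⊗ₜ[ℤ] _ - (1 : R) ⊗ₜ[ℤ] _)
        rw [← TensorProduct.tmul_sub, TensorProduct.smul_tmul', smul_eq_mul, mul_one]
      rw [this]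
      exact Submodule.smul_mem _ _ (Submodule.sub_mem _ (h y) (h z))

theorem linearMap_ext_bisetCoset {A : Type*} [AddCommMonoid A] [Module R A]
    {f g : DoubleBurnsideAlgebra R G →ₗ[R] A} (h : ∀ L, f (bisetCoset R L) = g (bisetCoset R L)) :
    f = g :=
  LinearMap.ext_on_range (span_range_bisetCoset R) h

theorem bisetCoset_mul (L L' : Subgroup (G × G))
    (h : ∀ b : G, ∃ a s t c, (a, s) ∈ L ∧ (t, c) ∈ L' ∧ b = s * t) :
    bisetCoset R L * bisetCoset R L' = bisetCoset R (relComp L L') := by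
  rw [bisetCoset_eq, bisetCoset_eq, classHom_mk_mul,
    BisetClass.mk_eq (FinBiset.coset_comp_coset L L' h), bisetCoset_eq]

theorem bisetCoset_mul_of_left {L : Subgroup (G × G)} (L' : Subgroup (G × G))
    (h : ∀ b, ∃ a, (a, b) ∈ L) :
    bisetCoset R L * bisetCoset R L' = bisetCoset R (relComp L L') :=
  bisetCoset_mul R L L' fun b => (h b).elim fun a ha =>
    ⟨a, b, 1, 1, ha, L'.one_mem, (mul_one b).symm⟩

theorem bisetCoset_mul_of_right (L : Subgroup (G × G)) {L' : Subgroup (G × G)}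
    (h : ∀ a, ∃ b, (a, b) ∈ L') :
    bisetCoset R L * bisetCoset R L' = bisetCoset R (relComp L L') :=
  bisetCoset_mul R L L' fun b => (h b).elim fun c hc =>
    ⟨1, 1, b, c, L.one_mem, hc, (one_mul b).symm⟩

/-- The class of the biset `G / M`, for `M` normal in `G`. -/
noncomputable def quotientClass (M : NormalSubgroup G) : DoubleBurnsideAlgebra R G :=
  bisetCoset R (deltaSubgroup M)

theorem quotientClass_mul_bisetCoset (M : NormalSubgroup G) (L : Subgroup (G × G)) :
    quotientClass R M * bisetCoset R L = bisetCoset R (relComp (deltaSubgroup M) L) :=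
  bisetCoset_mul_of_left R L (isSubdirect_deltaSubgroup M).2

theorem bisetCoset_mul_quotientClass (M : NormalSubgroup G) (L : Subgroup (G × G)) :
    bisetCoset R L * quotientClass R M = bisetCoset R (relComp L (deltaSubgroup M)) :=
  bisetCoset_mul_of_right R L (isSubdirect_deltaSubgroup M).1

theorem quotientClass_mul_bisetCoset_of_le {M : NormalSubgroup G} {L : Subgroup (G × G)}
    (h : M.1 ≤ L.goursatFst) : quotientClass R M * bisetCoset R L = bisetCoset R L := by
  rw [quotientClass_mul_bisetCoset]
  congr 1
  ext ⟨a, b⟩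
  constructor
  · rintro ⟨c, h1, h2⟩
    have := L.mul_mem (Subgroup.mem_goursatFst.1 (h h1)) h2
    simpa using this
  · intro h1
    exact ⟨a, by simp [mem_deltaSubgroup], h1⟩

theorem bisetCoset_mul_quotientClass_of_le {M : NormalSubgroup G} {L : Subgroup (G × G)}
    (h : M.1 ≤ L.goursatSnd) : bisetCoset R L * quotientClass R M = bisetCoset R L := by
  rw [bisetCoset_mul_quotientClass]
  congr 1
  ext ⟨a, b⟩
  constructor
  · rintro ⟨c, h1, h2⟩
    have h3 := M.2.conj_mem _ (M.1.inv_mem h2) c⁻¹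
    have h4 := L.mul_mem h1 (Subgroup.mem_goursatSnd.1 (h h3))
    simpa [mul_assoc] using h4
  · intro h1
    exact ⟨b, h1, by simp [mem_deltaSubgroup]⟩

/-- The trivial normal subgroup. -/
abbrev NormalSubgroup.bot : NormalSubgroup G := ⟨⊥, inferInstance⟩

theorem quotientClass_bot_mul (x : DoubleBurnsideAlgebra R G) :
    quotientClass R NormalSubgroup.bot * x = x := by
  have : LinearMap.mulLeft R (quotientClass R (NormalSubgroup.bot : NormalSubgroup G)) =
      LinearMap.id :=
    linearMap_ext_bisetCoset R fun L => quotientClass_mul_bisetCoset_of_le R bot_le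
  exact LinearMap.congr_fun this x

theorem mul_quotientClass_bot (x : DoubleBurnsideAlgebra R G) :
    x * quotientClass R NormalSubgroup.bot = x := by
  have : LinearMap.mulRight R (quotientClass R (NormalSubgroup.bot : NormalSubgroup G)) =
      LinearMap.id :=
    linearMap_ext_bisetCoset R fun L => bisetCoset_mul_quotientClass_of_le R bot_le
  exact LinearMap.congr_fun this x

theorem quotientClass_mul_quotientClass (M N : NormalSubgroup G) :
    quotientClass R M * quotientClass R N = quotientClass R (M.join N) := by
  refine (quotientClass_mul_bisetCoset R M _).trans ?_
  unfold quotientClass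
  congr 1
  have := N.2
  ext ⟨a, c⟩
  rw [mem_deltaSubgroup]
  constructor
  · rintro ⟨b, h1, h2⟩
    have := Subgroup.mul_mem_sup (mem_deltaSubgroup.1 h1) (mem_deltaSubgroup.1 h2)
    rwa [mul_assoc, inv_mul_cancel_left] at this
  · intro h
    obtain ⟨m, hm, n, hn, h'⟩ := Subgroup.mem_sup_of_normal_right.1 h
    -- Writing ac⁻¹ = mn, the intermediate point is m⁻¹a, which equals nc.
    refine ⟨m⁻¹ * a, ?_, ?_⟩
    · simpa [mem_deltaSubgroup] using hm
    · change m⁻¹ * a * c⁻¹ ∈ N.1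
      rw [mul_assoc, ← h', inv_mul_cancel_left]
      exact hn

/-! ### The top idempotent: vanishing, idempotency and commutation -/

section TopIdempotent

theorem tilde_gsetCoset (K : Subgroup G) :
    tilde R G (gsetCoset R K) = bisetCoset R (diagSubgroup K) := by
  unfold tilde gsetCoset
  rw [LinearMap.baseChange_tmul, bisetCoset_eq, ← BisetClass.mk_eq (FinBiset.tilde_coset K)]
  change (1 : R) ⊗ₜ[ℤ] (tildeHom G _) = _
  unfold tildeHom
  rw [GrothendieckRing.lift_of]
  rfl

/-- The finite set of all subgroups of `G`. -/
noncomputable def allSubgroups (G : Type u) [Group G] [Finite G] : Finset (Subgroup G) :=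
  (Set.toFinite {K : Subgroup G | K ≤ ⊤}).toFinset

theorem mem_allSubgroups (K : Subgroup G) : K ∈ allSubgroups G := by
  simp [allSubgroups]

theorem topIdempotent_eq :
    topIdempotent R G = Ring.inverse (Nat.card G : R) • ∑ K ∈ allSubgroups G,
      ((Nat.card K : R) * (moebius K ⊤ : R)) • bisetCoset R (diagSubgroup K) := by
  unfold topIdempotent burnsideIdempotent
  have h : (Nat.card (Subgroup.normalizer ((⊤ : Subgroup G) : Set G)) : R) = Nat.card G := by
    rw [Subgroup.normalizer_eq_top]
    simp
  rw [h, map_smul, map_sum]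
  simp only [map_smul, tilde_gsetCoset]
  rfl

variable {R}

theorem topIdempotent_mul_bisetCoset (hR : IsUnit (Nat.card G : R)) {L : Subgroup (G × G)}
    (hL : ¬ ∀ a, ∃ b, (a, b) ∈ L) : topIdempotent R G * bisetCoset R L = 0 := by
  have hΓ : IsUnit (Nat.card (G × G) : R) := by
    rw [Nat.card_prod, Nat.cast_mul]
    exact hR.mul hR
  have hL' : L.map (MonoidHom.fst G G) ≠ ⊤ := fun h => hL fun a => by
    obtain ⟨⟨a, b⟩, h', rfl⟩ := (h ▸ Subgroup.mem_top a : a ∈ L.map (MonoidHom.fst G G))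
    exact ⟨b, h'⟩
  have key := sum_moebius_res_prod_eq_zero hΓ ((classHom R).comp BisetClass.ofGSetHom)
    (MonoidHom.fst G G) hL' (allSubgroups G) mem_allSubgroups
  rw [topIdempotent_eq, smul_mul_assoc, Finset.sum_mul, ← smul_zero (Ring.inverse (Nat.card G : R)), ← key]
  congr 1
  refine Finset.sum_congr rfl fun K _ => ?_
  rw [smul_mul_assoc, bisetCoset_eq, bisetCoset_eq,
    ← BisetClass.mk_eq (FinBiset.tilde_coset K), classHom_mk_mul]
  exact congrArg (_ • classHom R ·) (BisetClass.mk_eq (FinBiset.tilde_comp (FinGSet.coset K) (FinGSet.coset L)))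

theorem bisetCoset_mul_topIdempotent (hR : IsUnit (Nat.card G : R)) {L : Subgroup (G × G)}
    (hL : ¬ ∀ b, ∃ a, (a, b) ∈ L) : bisetCoset R L * topIdempotent R G = 0 := by
  have hΓ : IsUnit (Nat.card (G × G) : R) := by
    rw [Nat.card_prod, Nat.cast_mul]
    exact hR.mul hR
  have hL' : L.map (MonoidHom.snd G G) ≠ ⊤ := fun h => hL fun b => by
    obtain ⟨⟨a, b⟩, h', rfl⟩ := (h ▸ Subgroup.mem_top b : b ∈ L.map (MonoidHom.snd G G))
    exact ⟨a, h'⟩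
  have key := sum_moebius_res_prod_eq_zero hΓ ((classHom R).comp BisetClass.ofGSetHom)
    (MonoidHom.snd G G) hL' (allSubgroups G) mem_allSubgroups
  rw [topIdempotent_eq, mul_smul_comm, Finset.mul_sum, ← smul_zero (Ring.inverse (Nat.card G : R)), ← key]
  congr 1
  refine Finset.sum_congr rfl fun K _ => ?_
  rw [mul_smul_comm, bisetCoset_eq, bisetCoset_eq,
    ← BisetClass.mk_eq (FinBiset.tilde_coset K), classHom_mk_mul]
  exact congrArg (_ • classHom R ·) (BisetClass.mk_eq (FinBiset.comp_tilde (FinGSet.coset K) (FinGSet.coset L)))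

/-- Expand the right factor only. The diagonal of a proper subgroup does not project onto G, so the
left factor kills every term except K = ⊤, which is the identity after 1/|G| cancels |G|. -/
theorem topIdempotent_mul_self (hR : IsUnit (Nat.card G : R)) :
    topIdempotent R G * topIdempotent R G = topIdempotent R G := by
  conv_lhs => arg 2; rw [topIdempotent_eq]
  rw [mul_smul_comm, Finset.mul_sum, Finset.sum_eq_single ⊤]
  · have h : diagSubgroup (⊤ : Subgroup G) =
        deltaSubgroup (NormalSubgroup.bot : NormalSubgroup G) := by
      ext ⟨a, b⟩
      rw [mem_diagSubgroup, mem_deltaSubgroup, Subgroup.mem_bot, mul_inv_eq_one]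
      simp
    have h' := mul_quotientClass_bot R (topIdempotent R G)
    unfold quotientClass at h'
    rw [h, mul_smul_comm, h', moebius_self, smul_smul, Int.cast_one, mul_one, Subgroup.card_top,
      Ring.inverse_mul_cancel _ hR, one_smul]
  · intro K _ hK
    rw [mul_smul_comm, topIdempotent_mul_bisetCoset hR, smul_zero]
    intro h
    refine hK ((Subgroup.eq_top_iff' K).2 fun a => ?_)
    obtain ⟨b, hb⟩ := h a
    exact (mem_diagSubgroup.1 hb).2
  · intro h
    exact absurd (mem_allSubgroups ⊤) h

/-- Only K ≥ Φ have nonzero Möbius coefficient. For these M ≤ K, and both composites of the diagonal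
of K with Δ_M consist of the pairs in K × K that are congruent modulo M. -/
theorem topIdempotent_mul_quotientClass {M : NormalSubgroup G} (hM : M.1 ≤ frattini G) :
    topIdempotent R G * quotientClass R M = quotientClass R M * topIdempotent R G := by
  rw [topIdempotent_eq, smul_mul_assoc, mul_smul_comm, Finset.sum_mul, Finset.mul_sum]
  congr 1
  refine Finset.sum_congr rfl fun K _ => ?_
  by_cases hK : frattini G ≤ K
  · rw [smul_mul_assoc, mul_smul_comm, quotientClass_mul_bisetCoset, bisetCoset_mul_quotientClass]
    congr 2
    ext ⟨a, c⟩
    constructor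
    · rintro ⟨b, h1, h2⟩
      obtain ⟨rfl, h3⟩ := mem_diagSubgroup.1 h1
      refine ⟨c, h2, mem_diagSubgroup.2 ⟨rfl, ?_⟩⟩
      have := K.mul_mem (K.inv_mem (hK (hM (mem_deltaSubgroup.1 h2)))) h3
      simpa using this
    · rintro ⟨b, h1, h2⟩
      obtain ⟨rfl, h3⟩ := mem_diagSubgroup.1 h2
      refine ⟨a, mem_diagSubgroup.2 ⟨rfl, ?_⟩, h1⟩
      have := K.mul_mem (hK (hM (mem_deltaSubgroup.1 h1))) h3
      simpa using this
  · rw [moebius_top_eq_zero hK]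
    simp

end TopIdempotent

/-! ### The Frattini idempotent and its commutation with subdirect bisets -/

section FrattiniIdempotent

/-- The finite set of normal subgroups of `G` contained in the Frattini subgroup. -/
noncomputable def frattiniNormals (G : Type u) [Group G] [Finite G] : Finset (NormalSubgroup G) :=
  (Set.toFinite {M : NormalSubgroup G | NormalSubgroup.bot ≤ M ∧ M.1 ≤ frattini G}).toFinset

theorem mem_frattiniNormals {M : NormalSubgroup G} :
    M ∈ frattiniNormals G ↔ M.1 ≤ frattini G := by
  simp only [frattiniNormals, Set.Finite.mem_toFinset, Set.mem_ofPred_eq, and_iff_right_iff_imp]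
  exact fun _ => (bot_le : (⊥ : Subgroup G) ≤ M.1)

/-- The alternating sum of the classes of the bisets `G / M`, for `M ≤ Φ(G)` normal in `G`. -/
noncomputable def frattiniIdempotent : DoubleBurnsideAlgebra R G :=
  ∑ M ∈ frattiniNormals G, (moebius NormalSubgroup.bot M : R) • quotientClass R M

theorem coe_phiOne : (phiOne R G : DoubleBurnsideAlgebra R G) =
    topIdempotent R G * frattiniIdempotent R * topIdempotent R G := by
  unfold phiOne phi frattiniIdempotent
  rw [Finset.mul_sum, Finset.sum_mul, AddSubmonoidClass.coe_finsetSum]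
  refine Finset.sum_congr rfl fun M _ => ?_
  rw [mul_smul_comm, smul_mul_assoc]
  rfl

theorem frattiniIdempotent_mul_quotientClass {N : NormalSubgroup G} (hN : N.1 ≠ ⊥)
    (hN' : N.1 ≤ frattini G) : frattiniIdempotent R * quotientClass R N = 0 := by
  rw [frattiniIdempotent, Finset.sum_mul,
    ← sum_moebius_bot_join (frattiniNormals G) (fun _ => mem_frattiniNormals) hN hN'
      (quotientClass R)]
  refine Finset.sum_congr rfl fun M _ => ?_
  rw [smul_mul_assoc, quotientClass_mul_quotientClass, Int.cast_smul_eq_zsmul]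

theorem quotientClass_mul_frattiniIdempotent {N : NormalSubgroup G} (hN : N.1 ≠ ⊥)
    (hN' : N.1 ≤ frattini G) : quotientClass R N * frattiniIdempotent R = 0 := by
  rw [frattiniIdempotent, Finset.mul_sum,
    ← sum_moebius_bot_join (frattiniNormals G) (fun _ => mem_frattiniNormals) hN hN'
      (quotientClass R)]
  refine Finset.sum_congr rfl fun M _ => ?_
  rw [mul_smul_comm, quotientClass_mul_quotientClass, Int.cast_smul_eq_zsmul,
    NormalSubgroup.join_comm]

/-- In the expansion of f only the term at the trivial subgroup survives, and it has coefficient 1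
and acts as the identity. -/
theorem mul_frattiniIdempotent_eq_self {x : DoubleBurnsideAlgebra R G}
    (hx : ∀ M : NormalSubgroup G, M.1 ≠ ⊥ → M.1 ≤ frattini G → x * quotientClass R M = 0) :
    x * frattiniIdempotent R = x := by
  rw [frattiniIdempotent, Finset.mul_sum, Finset.sum_eq_single NormalSubgroup.bot]
  · rw [mul_smul_comm, moebius_self, Int.cast_one, one_smul, mul_quotientClass_bot]
  · intro M hM hM'
    rw [mul_smul_comm, hx M (fun h => hM' (Subtype.ext h)) (mem_frattiniNormals.1 hM), smul_zero]
  · intro h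
    exact absurd (mem_frattiniNormals.2 bot_le) h

theorem frattiniIdempotent_mul_eq_self {x : DoubleBurnsideAlgebra R G}
    (hx : ∀ M : NormalSubgroup G, M.1 ≠ ⊥ → M.1 ≤ frattini G → quotientClass R M * x = 0) :
    frattiniIdempotent R * x = x := by
  rw [frattiniIdempotent, Finset.sum_mul, Finset.sum_eq_single NormalSubgroup.bot]
  · rw [smul_mul_assoc, moebius_self, Int.cast_one, one_smul, quotientClass_bot_mul]
  · intro M hM hM'
    rw [smul_mul_assoc, hx M (fun h => hM' (Subtype.ext h)) (mem_frattiniNormals.1 hM), smul_zero]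
  · intro h
    exact absurd (mem_frattiniNormals.2 bot_le) h

theorem frattiniIdempotent_mul_self :
    frattiniIdempotent R * frattiniIdempotent R = (frattiniIdempotent R (G := G)) :=
  mul_frattiniIdempotent_eq_self R fun _ => frattiniIdempotent_mul_quotientClass R

theorem topIdempotent_mul_frattiniIdempotent :
    topIdempotent R G * frattiniIdempotent R = frattiniIdempotent R * topIdempotent R G := by
  rw [frattiniIdempotent, Finset.mul_sum, Finset.sum_mul]
  refine Finset.sum_congr rfl fun M hM => ?_
  rw [mul_smul_comm, smul_mul_assoc,
    topIdempotent_mul_quotientClass (mem_frattiniNormals.1 hM)]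

/-- With N = k₁ ∩ Φ ≠ 1, the biset absorbs q_N on the left, and f q_N = 0. -/
theorem frattiniIdempotent_mul_bisetCoset_eq_zero {L : Subgroup (G × G)} (hL : IsSubdirect L)
    (h : L.goursatFst ⊓ frattini G ≠ ⊥) : frattiniIdempotent R * bisetCoset R L = 0 := by
  have := hL.normal_goursatFst
  let N : NormalSubgroup G := ⟨L.goursatFst ⊓ frattini G, inferInstance⟩
  rw [← quotientClass_mul_bisetCoset_of_le R (M := N) (L := L) inf_le_left, ← mul_assoc,
    frattiniIdempotent_mul_quotientClass R (N := N) h inf_le_right, zero_mul]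

theorem bisetCoset_mul_frattiniIdempotent_eq_zero {L : Subgroup (G × G)} (hL : IsSubdirect L)
    (h : L.goursatSnd ⊓ frattini G ≠ ⊥) : bisetCoset R L * frattiniIdempotent R = 0 := by
  have := hL.normal_goursatSnd
  let N : NormalSubgroup G := ⟨L.goursatSnd ⊓ frattini G, inferInstance⟩
  rw [← bisetCoset_mul_quotientClass_of_le R (M := N) (L := L) inf_le_left, mul_assoc,
    quotientClass_mul_frattiniIdempotent R (N := N) h inf_le_right, mul_zero]

/-- This is how nilpotency enters the commutation of f with transitive bisets: it transfers
triviality from one Goursat kernel to the other. -/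
theorem IsSubdirect.goursat_inf_frattini_eq_bot_iff (hG : Group.IsNilpotent G)
    {L : Subgroup (G × G)} (hL : IsSubdirect L) :
    L.goursatFst ⊓ frattini G = ⊥ ↔ L.goursatSnd ⊓ frattini G = ⊥ := by
  rw [← Subgroup.card_eq_one, hL.card_goursat_inf_frattini hG, Subgroup.card_eq_one]

/-- For a nilpotent group, the Frattini idempotent commutes with the transitive bisets
`(G × G) / L` for which both projections of `L` are surjective. -/
theorem frattiniIdempotent_mul_bisetCoset (hG : Group.IsNilpotent G) {L : Subgroup (G × G)}
    (hL : IsSubdirect L) :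
    frattiniIdempotent R * bisetCoset R L = bisetCoset R L * frattiniIdempotent R := by
  -- It suffices that f [L] q_M = 0. The second kernel of L ∘ Δ_M contains M, so its first kernel
  -- also meets Φ nontrivially, and f annihilates the class.
  have h1 : frattiniIdempotent R * bisetCoset R L * frattiniIdempotent R =
      frattiniIdempotent R * bisetCoset R L := by
    refine mul_frattiniIdempotent_eq_self R fun M hM hM' => ?_
    have hL' := hL.relComp (isSubdirect_deltaSubgroup M)
    rw [mul_assoc, bisetCoset_mul_quotientClass]
    refine frattiniIdempotent_mul_bisetCoset_eq_zero R hL' fun h => hM ?_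
    rw [hL'.goursat_inf_frattini_eq_bot_iff hG] at h
    refine le_bot_iff.1 (h ▸ le_inf (fun m hm => Subgroup.mem_goursatSnd.2 ?_) hM')
    exact ⟨1, L.one_mem, by simpa [mem_deltaSubgroup] using hm⟩
  have h2 : frattiniIdempotent R * (bisetCoset R L * frattiniIdempotent R) =
      bisetCoset R L * frattiniIdempotent R := by
    refine frattiniIdempotent_mul_eq_self R fun M hM hM' => ?_
    have hL' := (isSubdirect_deltaSubgroup M).relComp hL
    rw [← mul_assoc, quotientClass_mul_bisetCoset]
    refine bisetCoset_mul_frattiniIdempotent_eq_zero R hL' fun h => hM ?_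
    rw [← hL'.goursat_inf_frattini_eq_bot_iff hG] at h
    refine le_bot_iff.1 (h ▸ le_inf (fun m hm => Subgroup.mem_goursatFst.2 ?_) hM')
    exact ⟨1, by simpa [mem_deltaSubgroup] using hm, L.one_mem⟩
  rw [← h1, mul_assoc, h2]

variable {R}

theorem coe_phiOne_eq (hR : IsUnit (Nat.card G : R)) : (phiOne R G : DoubleBurnsideAlgebra R G) =
    frattiniIdempotent R * topIdempotent R G := by
  rw [coe_phiOne, topIdempotent_mul_frattiniIdempotent, mul_assoc, topIdempotent_mul_self hR]

/-- Both sides are linear in a, so transitive bisets suffice. If a projection of L is not onto, e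
kills both sides; otherwise f commutes with both e and [L]. -/
theorem frattiniIdempotent_commute_corner (hR : IsUnit (Nat.card G : R)) (hG : Group.IsNilpotent G)
    (a : DoubleBurnsideAlgebra R G) :
    frattiniIdempotent R * (topIdempotent R G * a * topIdempotent R G) =
      topIdempotent R G * a * topIdempotent R G * frattiniIdempotent R := by
  let e := topIdempotent R G
  let f := frattiniIdempotent R (G := G)
  have hef : e * f = f * e := topIdempotent_mul_frattiniIdempotent R
  have h : LinearMap.mulLeft R f ∘ₗ LinearMap.mulRight R e ∘ₗ LinearMap.mulLeft R e =
      LinearMap.mulRight R f ∘ₗ LinearMap.mulRight R e ∘ₗ LinearMap.mulLeft R e := by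
    refine linearMap_ext_bisetCoset R fun L => ?_
    change f * (e * bisetCoset R L * e) = e * bisetCoset R L * e * f
    by_cases h1 : ∀ a, ∃ b, (a, b) ∈ L
    · by_cases h2 : ∀ b, ∃ a, (a, b) ∈ L
      · have hfL : f * bisetCoset R L = bisetCoset R L * f :=
          frattiniIdempotent_mul_bisetCoset R hG ⟨h1, h2⟩
        rw [mul_assoc _ e f, hef, ← mul_assoc, ← mul_assoc, ← hef, mul_assoc e f, hfL]
        simp only [mul_assoc, hef]
      · rw [mul_assoc, show bisetCoset R L * e = 0 from bisetCoset_mul_topIdempotent hR h2]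
        simp
    · rw [show e * bisetCoset R L = 0 from topIdempotent_mul_bisetCoset hR h1]
      simp
  exact LinearMap.congr_fun h a

end FrattiniIdempotent

end Algebra

end DoubleBurnside

/-! ### The main theorem -/

theorem mainTheorem8 {R : Type v} [CommRing R] {G : Type u} [Group G] [Finite G]
    (hR : IsUnit (Nat.card G : R)) (hG : Group.IsNilpotent G) :
    IsIdempotentElem (DoubleBurnside.phiOne R G) ∧
      ∀ x : DoubleBurnside.essentialAlgebra R G,
        DoubleBurnside.phiOne R G * x = x * DoubleBurnside.phiOne R G := by
  open DoubleBurnside in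
  have he := topIdempotent_mul_self hR
  have hef := topIdempotent_mul_frattiniIdempotent R (G := G)
  refine ⟨Subtype.ext ?_, ?_⟩
  · change (phiOne R G : DoubleBurnsideAlgebra R G) * phiOne R G = phiOne R G
    rw [coe_phiOne_eq hR, mul_assoc, ← mul_assoc (topIdempotent R G), hef,
      mul_assoc _ (topIdempotent R G), he, ← mul_assoc, frattiniIdempotent_mul_self]
  -- For x = e a e, absorbing e gives φ x = f e x = f x = x f = x e f = x φ.
  · rintro ⟨_, a, rfl⟩
    refine Subtype.ext ?_
    change (phiOne R G : DoubleBurnsideAlgebra R G) * (topIdempotent R G * a * topIdempotent R G) =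
      topIdempotent R G * a * topIdempotent R G * phiOne R G
    rw [coe_phiOne_eq hR, mul_assoc, ← mul_assoc (topIdempotent R G), ← mul_assoc (topIdempotent R G),
      he, frattiniIdempotent_commute_corner hR hG, ← hef, ← mul_assoc,
      mul_assoc _ (topIdempotent R G) (topIdempotent R G), he]
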